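/- Let $R=\hat{\mathbb Z}$, $\Gamma={\rm SL}_2(\mathbb Z)$, $Y=M_2(R)\times\mathbb H$ and $X=\Gamma\backslash Y$, where $g\in{\rm GL}_2^+(\mathbb Q)$ acts (partially) on $Y$ by $g(\rho,\tau)=(g\rho,g\tau)$, the product $g\rho$ being computed in matrices over the finite adeles and $g\tau$ being the fractional linear transformation; we write $gy\in Y$ when $g\rho\in M_2(R)$. Let $Z$ be the quotient of $\{(g,y)\in {\rm GL}_2^+(\mathbb Q)\times Y : gy\in Y\}$ (with ${\rm GL}_2^+(\mathbb Q)$ discrete) by the action $(\gamma_1,\gamma_2)(g,y)=(\gamma_1g\gamma_2^{-1},\gamma_2y)$ of $\Gamma\times\Gamma$, and let $\mathcal A=C_c(Z)$, with the convolution product and involution $$(f_1*f_2)(g,y)=\sum_{h\in\Gamma\backslash{\rm GL}_2^+(\mathbb Q),\,hy\in Y}f_1(gh^{-1},hy)\,f_2(h,y),\qquad f^*(g,y)=\overline{f(g^{-1},gy)}.$$ For $y\in Y$ let $G_y=\{g\in {\rm GL}_2^+(\mathbb Q): gy\in Y\}$ and let $\pi_y$ be the representation of $\mathcal A$ in $\ell^2(\Gamma\backslash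 G_y)$ given by $(\pi_y(f)\xi)(g)=\sum_{h\in\Gamma\backslash G_y}f(gh^{-1},hy)\,\xi(h)$. Let $A$ be the $C^*$-algebra obtained by completing $\mathcal A$ for the norm $\|f\|=\sup_{y\in Y}\|\pi_y(f)\|$, and let $(\sigma_t)_{t\in\mathbb R}$ be the one-parameter group of automorphisms of $A$ determined by $\sigma_t(f)(g,y)=(\det g)^{it}f(g,y)$ for $f\in\mathcal A$. Endow $X$ with the measure $dy=d\rho\times d\mu(\tau)$, where $d\rho$ is the normalized Haar measure of the additive compact group $M_2(R)$ and $\mu$ is the measure of the Poincaré metric on $\mathbb H$, normalized so that $\mu(\Gamma\backslash\mathbb H)=1$; that is, the integral over $X$ is the integral over $M_2(R)\times\mathcal D$, with $\mathcal D$ the standard fundamental domain of $\Gamma$ in $\mathbb H$. Then, for every $f\in\mathcal A$, the function $y\mapsto f(1,y)$ is integrable on $X$, and the formula $$\varphi(f)=\int_X f(1,y)\,dy\qquad(f\in\mathcal A)$$ extends uniquely to a continuous linear form $\varphi$ on $A$. This $\varphi$ is a state on $A$ (a positive linear form of norm one), and it is a KMS$_2$ state for $\sigma_t$: for all $a,b\in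 A$ there is a bounded continuous function $F$ on the strip $0\le{\rm Im}\,z\le 2$, holomorphic in its interior, such that $F(t)=\varphi(a\,\sigma_t(b))$ and $F(t+2i)=\varphi(\sigma_t(b)\,a)$ for all $t\in\mathbb R$. -/

import Mathlib

open MeasureTheory

namespace GL2System

noncomputable section

open Matrix UpperHalfPlane Topology
open scoped MatrixGroups ENNReal CompactlySupported

/-! ### The profinite integers and the partial action of `GL₂⁺(ℚ)` -/

/-- The prime numbers. -/
abbrev P : Type := {p : ℕ // p.Prime}

instance factPrimes (p : P) : Fact (p : ℕ).Prime := ⟨p.2⟩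

/-- The ring `R = Ẑ` of profinite integers, as the product of the rings `ℤ_p`. -/
abbrev Zhat : Type := ∀ p : P, ℤ_[(p : ℕ)]

/-- The product of all the fields `ℚ_p`, an ambient ring of the finite adeles. -/
abbrev Qhat : Type := ∀ p : P, ℚ_[(p : ℕ)]

/-- The compact ring `M₂(R)`. -/
abbrev M2R : Type := Matrix (Fin 2) (Fin 2) Zhat

/-- The inclusion `R → ∏ ℚ_p`. -/
def zhatToQhat : Zhat →+* Qhat :=
  RingHom.pi fun p => PadicInt.Coe.ringHom.comp (Pi.evalRingHom _ p)

/-- The inclusion of `M₂(R)` in the matrices over `∏ ℚ_p`. -/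
def emb : M2R →+* Matrix (Fin 2) (Fin 2) Qhat := zhatToQhat.mapMatrix

lemma emb_apply (ρ : M2R) (i j : Fin 2) (p : P) : emb ρ i j p = (ρ i j p : ℚ_[(p : ℕ)]) :=
  rfl

lemma emb_injective : Function.Injective emb := by
  intro a b h
  ext i j p
  have := congrFun (congrFun (congrFun h i) j) p
  exact Subtype.ext this

/-- The group `GL₂⁺(ℚ)` of rational two by two matrices of positive determinant, as a discrete
group. -/
def GQ : Type := GL(2, ℚ)⁺

instance : Group GQ := inferInstanceAs (Group GL(2, ℚ)⁺)
instance : TopologicalSpace GQ := ⊥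
instance : DiscreteTopology GQ := ⟨rfl⟩

/-- The inclusion `GL₂⁺(ℚ) → GL₂(ℚ)`. -/
def GQ.toGL : GQ →* GL (Fin 2) ℚ := Subgroup.subtype GL(2, ℚ)⁺

/-- The determinant, as a real number. -/
def GQ.det (g : GQ) : ℝ := ((g.toGL : Matrix (Fin 2) (Fin 2) ℚ).det : ℚ)

/-- The inclusion of `Γ = SL₂(ℤ)` in `GL₂⁺(ℚ)`. -/
def ofSL : SL(2, ℤ) →* GQ :=
  (Matrix.SpecialLinearGroup.toGLPos (n := Fin 2) (R := ℚ)).comp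
    (Matrix.SpecialLinearGroup.map (Int.castRingHom ℚ))

/-- A rational matrix, seen in the matrices over `∏ ℚ_p`. -/
def GQ.mat : GQ →* Matrix (Fin 2) (Fin 2) Qhat :=
  (((algebraMap ℚ Qhat).mapMatrix : Matrix (Fin 2) (Fin 2) ℚ →+* _) : _ →* _).comp
    ((Units.coeHom _).comp GQ.toGL)

lemma GQ.mat_apply (g : GQ) (i j : Fin 2) (p : P) :
    g.mat i j p = (((g.toGL : Matrix (Fin 2) (Fin 2) ℚ) i j : ℚ) : ℚ_[(p : ℕ)]) := by
  change (algebraMap ℚ Qhat) _ p = _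
  simp

/-- The action of `GL₂⁺(ℚ)` on the upper half plane by fractional linear transformations. -/
instance : MulAction GQ ℍ :=
  MulAction.compHom ℍ ((Matrix.GeneralLinearGroup.map (algebraMap ℚ ℝ)).comp GQ.toGL)

/-- The condition `g ρ ∈ M₂(R)`. -/
def InM2 (g : GQ) (ρ : M2R) : Prop := g.mat * emb ρ ∈ Set.range emb

/-- The product `g ρ ∈ M₂(R)`, when it is defined. -/
def gmul (g : GQ) (ρ : M2R) (h : InM2 g ρ) : M2R := Classical.choose h

lemma emb_gmul (g : GQ) (ρ : M2R) (h : InM2 g ρ) : emb (gmul g ρ h) = g.mat * emb ρ :=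
  Classical.choose_spec h

lemma eq_gmul {g : GQ} {ρ σ : M2R} (e : emb σ = g.mat * emb ρ) : σ = gmul g ρ ⟨σ, e⟩ :=
  emb_injective (e.trans (emb_gmul g ρ _).symm)

/-- The space `Y = M₂(R) × ℍ`. -/
abbrev Y : Type := M2R × ℍ

/-- The partial action `(ρ, τ) ↦ (g ρ, g τ)` of `GL₂⁺(ℚ)` on `Y`, defined when `g ρ ∈ M₂(R)`. -/
def act (g : GQ) (y : Y) (h : InM2 g y.1) : Y := (gmul g y.1 h, g • y.2)

/-- `Γ` acts on `M₂(R)` by left multiplication. -/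
instance : MulAction SL(2, ℤ) M2R where
  smul γ ρ := (Int.castRingHom Zhat).mapMatrix (γ : Matrix (Fin 2) (Fin 2) ℤ) * ρ
  one_smul ρ := by
    change (Int.castRingHom Zhat).mapMatrix ((1 : SL(2, ℤ)) : Matrix (Fin 2) (Fin 2) ℤ) * ρ = ρ
    simp
  mul_smul γ δ ρ := by
    change (Int.castRingHom Zhat).mapMatrix ((γ * δ : SL(2, ℤ)) : Matrix (Fin 2) (Fin 2) ℤ) * ρ =
      (Int.castRingHom Zhat).mapMatrix (γ : Matrix (Fin 2) (Fin 2) ℤ) *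
      ((Int.castRingHom Zhat).mapMatrix (δ : Matrix (Fin 2) (Fin 2) ℤ) * ρ)
    rw [Matrix.SpecialLinearGroup.coe_mul, map_mul, mul_assoc]

lemma smul_M2R_def (γ : SL(2, ℤ)) (ρ : M2R) :
    γ • ρ = (Int.castRingHom Zhat).mapMatrix (γ : Matrix (Fin 2) (Fin 2) ℤ) * ρ := rfl

lemma mat_ofSL (γ : SL(2, ℤ)) :
    (ofSL γ).mat = emb ((Int.castRingHom Zhat).mapMatrix (γ : Matrix (Fin 2) (Fin 2) ℤ)) := by
  ext i j p
  rw [GQ.mat_apply]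
  change (((γ.1 i j : ℤ) : ℚ) : ℚ_[(p : ℕ)]) = (((((γ.1 i j : ℤ) : Zhat)) p : ℤ_[(p : ℕ)]) : ℚ_[(p : ℕ)])
  simp

lemma emb_smul (γ : SL(2, ℤ)) (ρ : M2R) : emb (γ • ρ) = (ofSL γ).mat * emb ρ := by
  rw [smul_M2R_def, map_mul, mat_ofSL]

lemma ofSL_smul (γ : SL(2, ℤ)) (τ : ℍ) : ofSL γ • τ = γ • τ := by
  change (Matrix.GeneralLinearGroup.map (algebraMap ℚ ℝ)) (ofSL γ).toGL • τ =
    Matrix.SpecialLinearGroup.mapGL ℝ γ • τ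
  congr 1
  ext i j
  change (((γ.1 i j : ℤ) : ℚ) : ℝ) = ((γ.1 i j : ℤ) : ℝ)
  simp

lemma det_pos (g : GQ) : 0 < g.det := by
  have h : 0 < (Matrix.GeneralLinearGroup.det g.1 : ℚ) := g.2
  change (0 : ℝ) < ((Matrix.GeneralLinearGroup.det g.1 : ℚ) : ℝ)
  exact_mod_cast h

lemma det_mul (g h : GQ) : (g * h).det = g.det * h.det := by
  simp [GQ.det]

lemma det_ofSL (γ : SL(2, ℤ)) : (ofSL γ).det = 1 := by
  have h : ((Matrix.SpecialLinearGroup.map (Int.castRingHom ℚ) γ : SL(2, ℚ)) :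
    Matrix (Fin 2) (Fin 2) ℚ).det = 1 := Matrix.SpecialLinearGroup.det_coe _
  change (((Matrix.SpecialLinearGroup.map (Int.castRingHom ℚ) γ : SL(2, ℚ)) :
    Matrix (Fin 2) (Fin 2) ℚ).det : ℝ) = 1
  rw [h]; simp

lemma det_one : (1 : GQ).det = 1 := by simpa using det_ofSL 1

lemma det_inv (g : GQ) : g⁻¹.det = g.det⁻¹ := by
  have h := det_mul g g⁻¹
  rw [mul_inv_cancel, det_one] at h
  exact eq_inv_of_mul_eq_one_right h.symm

lemma ofSL_injective : Function.Injective ofSL := by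
  intro a b h
  ext i j
  have h2 : ((a.1 i j : ℤ) : ℚ) = ((b.1 i j : ℤ) : ℚ) :=
    congrFun (congrFun (congrArg (fun g : GQ => (g.toGL : Matrix (Fin 2) (Fin 2) ℚ)) h) i) j
  exact_mod_cast h2

lemma inM2_one (ρ : M2R) : InM2 1 ρ := ⟨ρ, by simp⟩

lemma inM2_mul {g h : GQ} {ρ : M2R} (hh : InM2 h ρ) :
    InM2 (g * h) ρ ↔ InM2 g (gmul h ρ hh) := by
  unfold InM2
  rw [emb_gmul, map_mul, mul_assoc]

lemma inM2_inv {g : GQ} {ρ : M2R} (h : InM2 g ρ) : InM2 g⁻¹ (gmul g ρ h) :=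
  ⟨ρ, by rw [emb_gmul, ← mul_assoc, ← map_mul]; simp⟩

lemma inM2_ofSL (γ : SL(2, ℤ)) (ρ : M2R) : InM2 (ofSL γ) ρ := ⟨γ • ρ, emb_smul γ ρ⟩

lemma inM2_mul_act {g h : GQ} {y : Y} (hh : InM2 h y.1) :
    InM2 (g * h) y.1 ↔ InM2 g (act h y hh).1 := inM2_mul hh

lemma inM2_inv_act {g : GQ} {y : Y} (h : InM2 g y.1) : InM2 g⁻¹ (act g y h).1 := inM2_inv h

lemma inM2_ofSL_act {g : GQ} {y : Y} (γ : SL(2, ℤ)) (h : InM2 g y.1) :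
    InM2 (ofSL γ * g) y.1 := (inM2_mul_act h).2 (inM2_ofSL _ _)

lemma act_one (y : Y) (h : InM2 1 y.1) : act 1 y h = y := by
  refine Prod.ext ?_ (one_smul _ _)
  exact (eq_gmul (by simp)).symm

lemma act_mul {g h : GQ} {y : Y} (hh : InM2 h y.1) (hg : InM2 g (act h y hh).1)
    (hgh : InM2 (g * h) y.1) : act g (act h y hh) hg = act (g * h) y hgh := by
  refine Prod.ext ?_ (mul_smul _ _ _).symm
  refine emb_injective ?_
  change emb (gmul _ _ _) = emb (gmul _ _ _)
  rw [emb_gmul, emb_gmul]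
  change _ * emb (gmul _ _ _) = _
  rw [emb_gmul, map_mul, mul_assoc]

lemma act_ofSL (γ : SL(2, ℤ)) (y : Y) (h : InM2 (ofSL γ) y.1) : act (ofSL γ) y h = γ • y := by
  refine Prod.ext ?_ (ofSL_smul _ _)
  exact (eq_gmul (emb_smul γ y.1)).symm

lemma act_congr {g g' : GQ} {y y' : Y} (hg : g = g') (hy : y = y') (h : InM2 g y.1)
    (h' : InM2 g' y'.1) : act g y h = act g' y' h' := by
  subst hg; subst hy; rfl

/-! ### The spaces `X` and `Z` -/

/-- The space `X = Γ \ Y` of `ℚ`-lattices up to scaling. -/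
abbrev X : Type := MulAction.orbitRel.Quotient SL(2, ℤ) Y

/-- The space of pairs `(g, y)` in `GL₂⁺(ℚ) × Y` with `g y ∈ Y`. -/
abbrev D : Type := {x : GQ × Y // InM2 x.1 x.2.1}

lemma inM2_smul {g : GQ} {ρ : M2R} (a b : SL(2, ℤ)) (h : InM2 g ρ) :
    InM2 (ofSL a * g * (ofSL b)⁻¹) (b • ρ) := by
  refine ⟨a • gmul g ρ h, ?_⟩
  rw [emb_smul, emb_smul, emb_gmul, ← mul_assoc, ← mul_assoc, ← map_mul, ← map_mul]
  simp

/-- The action `(γ₁, γ₂) (g, y) = (γ₁ g γ₂⁻¹, γ₂ y)` of `Γ × Γ`. -/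
instance : MulAction (SL(2, ℤ) × SL(2, ℤ)) D where
  smul c x := ⟨(ofSL c.1 * x.1.1 * (ofSL c.2)⁻¹, c.2 • x.1.2), inM2_smul c.1 c.2 x.2⟩
  one_smul x := by
    refine Subtype.ext (Prod.ext ?_ ?_)
    · change ofSL 1 * x.1.1 * (ofSL 1)⁻¹ = _
      simp
    · exact one_smul _ _
  mul_smul c d x := by
    refine Subtype.ext (Prod.ext ?_ ?_)
    · change ofSL (c.1 * d.1) * x.1.1 * (ofSL (c.2 * d.2))⁻¹ =
        ofSL c.1 * (ofSL d.1 * x.1.1 * (ofSL d.2)⁻¹) * (ofSL c.2)⁻¹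
      simp [mul_assoc]
    · exact mul_smul _ _ _

lemma smul_D_fst (c : SL(2, ℤ) × SL(2, ℤ)) (x : D) :
    (c • x).1.1 = ofSL c.1 * x.1.1 * (ofSL c.2)⁻¹ := rfl

lemma smul_D_snd (c : SL(2, ℤ) × SL(2, ℤ)) (x : D) : (c • x).1.2 = c.2 • x.1.2 := rfl

/-- The locally compact space `Z`, quotient of the pairs `(g, y)` by `Γ × Γ`. -/
abbrev Z : Type := MulAction.orbitRel.Quotient (SL(2, ℤ) × SL(2, ℤ)) D

/-- The class in `Z` of a pair `(g, y)` with `g y ∈ Y`. -/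
def mk (g : GQ) (y : Y) (h : InM2 g y.1) : Z := Quotient.mk _ ⟨(g, y), h⟩

lemma mk_congr {g g' : GQ} {y y' : Y} (hg : g = g') (hy : y = y') (h : InM2 g y.1)
    (h' : InM2 g' y'.1) : mk g y h = mk g' y' h' := by
  subst hg; subst hy; rfl

lemma mk_eq {g g' : GQ} {y y' : Y} (a b : SL(2, ℤ)) (hg : g' = ofSL a * g * (ofSL b)⁻¹)
    (hy : y' = b • y) (h : InM2 g y.1) (h' : InM2 g' y'.1) : mk g' y' h' = mk g y h := by
  refine Quotient.sound ⟨(a, b), ?_⟩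
  exact Subtype.ext (Prod.ext hg.symm hy.symm)

/-! ### Topology -/

instance : CompactSpace M2R := inferInstanceAs (CompactSpace (Fin 2 → Fin 2 → Zhat))
instance : SecondCountableTopology M2R :=
  inferInstanceAs (SecondCountableTopology (Fin 2 → Fin 2 → Zhat))

lemma isEmbedding_emb : IsEmbedding (emb : M2R → Matrix (Fin 2) (Fin 2) Qhat) := by
  refine .piMap (f := fun _ : Fin 2 => fun (v : Fin 2 → Zhat) (j : Fin 2) => zhatToQhat (v j))
    fun _ => .piMap (f := fun _ : Fin 2 => fun v : Zhat => zhatToQhat v) fun _ =>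
      .piMap (f := fun p : P => fun v : ℤ_[(p : ℕ)] => (v : ℚ_[(p : ℕ)])) fun p => ?_
  exact IsEmbedding.subtypeVal

lemma mem_range_emb (m : Matrix (Fin 2) (Fin 2) Qhat) :
    m ∈ Set.range emb ↔ ∀ i j p, ‖m i j p‖ ≤ 1 := by
  constructor
  · rintro ⟨ρ, rfl⟩ i j p
    exact (ρ i j p).2
  · intro h
    exact ⟨fun i j p => ⟨m i j p, h i j p⟩, rfl⟩

lemma continuous_mat_mul (g : GQ) : Continuous fun ρ : M2R => g.mat * emb ρ :=
  continuous_const.matrix_mul isEmbedding_emb.continuous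

lemma norm_mat_mul_le {g : GQ} {p : P} (hp : ∀ i j, ‖g.mat i j p‖ ≤ 1) (ρ : M2R) (i j : Fin 2) :
    ‖(g.mat * emb ρ) i j p‖ ≤ 1 := by
  have e : (g.mat * emb ρ) i j p = g.mat i 0 p * emb ρ 0 j p + g.mat i 1 p * emb ρ 1 j p := by
    rw [Matrix.mul_apply, Fin.sum_univ_two]; rfl
  rw [e]
  refine (IsUltrametricDist.norm_add_le_max _ _).trans (max_le ?_ ?_)
  all_goals
    rw [norm_mul]
    exact mul_le_one₀ (hp _ _) (norm_nonneg _) (PadicInt.norm_le_one _)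

lemma finite_bad (g : GQ) : {p : P | ¬ ∀ i j, ‖g.mat i j p‖ ≤ 1}.Finite := by
  have : {p : P | ¬ ∀ i j, ‖g.mat i j p‖ ≤ 1} ⊆
      ⋃ i, ⋃ j, (Subtype.val : P → ℕ) ⁻¹'
        (((g.toGL : Matrix (Fin 2) (Fin 2) ℚ) i j).den.divisors : Set ℕ) := by
    intro p hp
    simp only [Set.mem_ofPred_eq, not_forall] at hp
    obtain ⟨i, j, h⟩ := hp
    refine Set.mem_iUnion.2 ⟨i, Set.mem_iUnion.2 ⟨j, ?_⟩⟩
    by_contra h'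
    refine h ?_
    rw [GQ.mat_apply]
    refine Padic.norm_rat_le_one fun hd => h' ?_
    simpa using hd
  refine Set.Finite.subset ?_ this
  refine Set.finite_iUnion fun i => Set.finite_iUnion fun j => ?_
  exact (Finset.finite_toSet _).preimage Subtype.val_injective.injOn

lemma isClopen_inM2 (g : GQ) : IsClopen {ρ : M2R | InM2 g ρ} := by
  have : {ρ : M2R | InM2 g ρ} = ⋂ p ∈ {p : P | ¬ ∀ i j, ‖g.mat i j p‖ ≤ 1}, ⋂ i, ⋂ j,
      (fun ρ : M2R => (g.mat * emb ρ) i j p) ⁻¹' Metric.closedBall 0 1 := by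
    ext ρ
    simp only [Set.mem_ofPred_eq, Set.mem_iInter, Set.mem_preimage, mem_closedBall_zero_iff]
    rw [InM2, mem_range_emb]
    constructor
    · intro h p _ i j
      exact h i j p
    · intro h i j p
      by_cases hp : ∀ i j, ‖g.mat i j p‖ ≤ 1
      · exact norm_mat_mul_le hp ρ i j
      · exact h p hp i j
  rw [this]
  refine (finite_bad g).isClopen_biInter fun p _ => isClopen_iInter_of_finite fun i =>
    isClopen_iInter_of_finite fun j => ?_
  refine (IsUltrametricDist.isClopen_closedBall (0 : ℚ_[(p : ℕ)]) one_ne_zero).preimage ?_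
  exact (continuous_apply p).comp ((continuous_mat_mul g).matrix_elem i j)

lemma continuous_gmul (g : GQ) : Continuous fun ρ : {ρ : M2R // InM2 g ρ} => gmul g ρ.1 ρ.2 := by
  rw [isEmbedding_emb.continuous_iff]
  have : emb ∘ (fun ρ : {ρ : M2R // InM2 g ρ} => gmul g ρ.1 ρ.2) =
      fun ρ => g.mat * emb ρ.1 := funext fun ρ => emb_gmul _ _ _
  rw [this]
  exact (continuous_mat_mul g).comp continuous_subtype_val

lemma continuous_smul_H (g : GQ) : Continuous fun τ : ℍ => g • τ := by
  have h := continuous_const_smul (T := ℍ)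
    ((Matrix.GeneralLinearGroup.map (n := Fin 2) (algebraMap ℚ ℝ)) g.toGL)
  exact h

lemma continuous_act (g : GQ) : Continuous fun y : {y : Y // InM2 g y.1} => act g y.1 y.2 := by
  have h1 : Continuous fun y : {y : Y // InM2 g y.1} => (⟨y.1.1, y.2⟩ : {ρ : M2R // InM2 g ρ}) :=
    Continuous.subtype_mk (continuous_fst.comp continuous_subtype_val) fun y => y.2
  have h2 : Continuous fun y : {y : Y // InM2 g y.1} => y.1.2 :=
    continuous_snd.comp continuous_subtype_val
  have h3 : Continuous fun y : {y : Y // InM2 g y.1} => gmul g y.1.1 y.2 := by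
    have := Continuous.comp (continuous_gmul g) h1
    simp only [Function.comp_def] at this
    exact this
  have h4 : Continuous fun y : {y : Y // InM2 g y.1} => g • y.1.2 :=
    (continuous_smul_H g).comp h2
  exact h3.prodMk h4

instance : ContinuousConstSMul SL(2, ℤ) M2R :=
  ⟨fun _ => continuous_const.matrix_mul continuous_id⟩

instance : ContinuousConstSMul SL(2, ℤ) ℍ :=
  ⟨fun γ => continuous_const_smul (Matrix.SpecialLinearGroup.mapGL ℝ γ)⟩

lemma isClopen_D : IsClopen {x : GQ × Y | InM2 x.1 x.2.1} := by
  have key : ∀ s : GQ → Set M2R, (∀ g, IsOpen (s g)) → IsOpen {x : GQ × Y | x.2.1 ∈ s x.1} := by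
    intro s hs
    have : {x : GQ × Y | x.2.1 ∈ s x.1} = ⋃ g : GQ, {g} ×ˢ (s g ×ˢ Set.univ) := by
      ext ⟨g, ρ, τ⟩; simp
    rw [this]
    exact isOpen_iUnion fun g => (isOpen_discrete _).prod ((hs g).prod isOpen_univ)
  refine ⟨⟨?_⟩, ?_⟩
  · exact key (fun g => {ρ | InM2 g ρ}ᶜ) fun g => (isClopen_inM2 g).compl.isOpen
  · exact key (fun g => {ρ | InM2 g ρ}) fun g => (isClopen_inM2 g).isOpen

instance : LocallyCompactSpace D := isClopen_D.isOpen.locallyCompactSpace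

instance : ContinuousConstSMul (SL(2, ℤ) × SL(2, ℤ)) D := by
  refine ⟨fun c => ?_⟩
  refine Continuous.subtype_mk (Continuous.prodMk ?_ ?_) _
  · exact (continuous_of_discreteTopology (f := fun g : GQ => ofSL c.1 * g * (ofSL c.2)⁻¹)).comp
      (continuous_fst.comp continuous_subtype_val)
  · exact (continuous_const_smul c.2).comp (continuous_snd.comp continuous_subtype_val)

lemma finite_SL {K L : Set ℍ} (hK : IsCompact K) (hL : IsCompact L) :
    {γ : SL(2, ℤ) | ((γ • ·) '' K ∩ L).Nonempty}.Finite := by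
  have h := ProperlyDiscontinuousSMul.finite_disjoint_inter_image (Γ := 𝒮ℒ) hK hL
  have hinj : Function.Injective (fun γ : SL(2, ℤ) =>
      (⟨Matrix.SpecialLinearGroup.mapGL ℝ γ, ⟨γ, rfl⟩⟩ : 𝒮ℒ)) := fun a b hab =>
    Matrix.SpecialLinearGroup.mapGL_injective (congrArg Subtype.val hab)
  refine (h.preimage (f := fun γ : SL(2, ℤ) =>
      (⟨Matrix.SpecialLinearGroup.mapGL ℝ γ, ⟨γ, rfl⟩⟩ : 𝒮ℒ)) hinj.injOn).subset ?_
  exact fun γ hγ => hγ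

instance : ProperlyDiscontinuousSMul (SL(2, ℤ) × SL(2, ℤ)) D := by
  refine ⟨fun {K L} hK hL => ?_⟩
  have c1 : Continuous fun x : D => x.1.1 := continuous_fst.comp continuous_subtype_val
  have c2 : Continuous fun x : D => x.1.2.2 :=
    continuous_snd.comp (continuous_snd.comp continuous_subtype_val)
  have hF := finite_SL (hK.image c2) (hL.image c2)
  have hA : ((fun x : D => x.1.1) '' K).Finite := (hK.image c1).finite_of_discrete
  have hB : ((fun x : D => x.1.1) '' L).Finite := (hL.image c1).finite_of_discrete
  have hG : {γ : SL(2, ℤ) | ofSL γ ∈ Set.image2 (fun (g : GQ) (q : GQ × SL(2, ℤ)) =>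
      g * ofSL q.2 * q.1⁻¹) ((fun x : D => x.1.1) '' L) (((fun x : D => x.1.1) '' K) ×ˢ
        {γ : SL(2, ℤ) | ((γ • ·) '' ((fun x : D => x.1.2.2) '' K) ∩
          ((fun x : D => x.1.2.2) '' L)).Nonempty})}.Finite :=
    (hB.image2 _ (hA.prod hF)).preimage ofSL_injective.injOn
  refine (hG.prod hF).subset ?_
  rintro ⟨a, b⟩ ⟨_, ⟨x, hx, rfl⟩, hx'⟩
  have hb : b ∈ {γ : SL(2, ℤ) | ((γ • ·) '' ((fun x : D => x.1.2.2) '' K) ∩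
          ((fun x : D => x.1.2.2) '' L)).Nonempty} :=
    ⟨b • x.1.2.2, ⟨_, ⟨x, hx, rfl⟩, rfl⟩, ⟨_, hx', rfl⟩⟩
  refine ⟨⟨_, ⟨_, hx', rfl⟩, (x.1.1, b), ⟨⟨x, hx, rfl⟩, hb⟩, ?_⟩, hb⟩
  change ofSL a * x.1.1 * (ofSL b)⁻¹ * ofSL b * x.1.1⁻¹ = ofSL a
  group


lemma continuous_mk : Continuous (Quotient.mk _ : D → Z) := continuous_quotient_mk'

lemma isOpenMap_mk : IsOpenMap (Quotient.mk _ : D → Z) := isOpenMap_quotient_mk'_mul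

/-! ### Finiteness of the Hecke correspondences and compact supports -/

lemma exists_reps (s : GQ) :
    ∃ T : Finset GQ, ∀ γ : SL(2, ℤ), ∃ δ : SL(2, ℤ), ∃ t ∈ T, s * ofSL γ = ofSL δ * t := by
  obtain ⟨⟨b, hb⟩, hM⟩ := IsLocalization.exist_integer_multiples_of_finite (nonZeroDivisors ℤ)
    (fun q : Fin 2 × Fin 2 => (s.toGL : Matrix (Fin 2) (Fin 2) ℚ) q.1 q.2)
  choose M' hM' using hM
  have hb0 : (b : ℚ) ≠ 0 := by exact_mod_cast nonZeroDivisors.ne_zero hb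
  let M : Matrix (Fin 2) (Fin 2) ℤ := fun i j => M' (i, j)
  have hMs : M.map (Int.cast : ℤ → ℚ) = (b : ℚ) • (s.toGL : Matrix (Fin 2) (Fin 2) ℚ) := by
    ext i j
    have := hM' (i, j)
    change ((M' (i, j) : ℤ) : ℚ) = _
    simpa using this
  have hdet : M.det ≠ 0 := by
    intro h0
    have h1 : (M.map (Int.cast : ℤ → ℚ)).det = 0 := by
      have := (Int.castRingHom ℚ).map_det M
      rw [h0] at this
      simpa using this.symm
    rw [hMs, Matrix.det_smul] at h1
    have h2 : ((s.toGL : Matrix (Fin 2) (Fin 2) ℚ)).det ≠ 0 := s.toGL.det_ne_zero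
    simp [hb0, h2] at h1
  have hred : ∀ A : FixedDetMatrix (Fin 2) ℤ M.det, ∃ δ : SL(2, ℤ),
      ∃ r ∈ FixedDetMatrices.reps M.det, A = δ • r := by
    intro A
    induction A using FixedDetMatrices.induction_on hdet with
    | h0 A h1 h2 h3 h4 => exact ⟨1, A, ⟨h1, h2, h3, h4⟩, (one_smul _ _).symm⟩
    | hS B h =>
      obtain ⟨δ, r, hr, rfl⟩ := h
      exact ⟨_, r, hr, smul_smul _ _ _⟩
    | hT B h =>
      obtain ⟨δ, r, hr, rfl⟩ := h
      exact ⟨_, r, hr, smul_smul _ _ _⟩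
  let φ : GQ → Matrix (Fin 2) (Fin 2) ℚ := fun g => (g.toGL : Matrix (Fin 2) (Fin 2) ℚ)
  have hφ : Function.Injective φ := fun g h e => Subtype.ext (Units.ext e)
  have hφm : ∀ g h, φ (g * h) = φ g * φ h := fun g h => by simp [φ]
  have hφγ : ∀ γ : SL(2, ℤ), φ (ofSL γ) = (γ.1).map (Int.cast : ℤ → ℚ) := fun γ => rfl
  have hfin : (φ ⁻¹' ((fun r : FixedDetMatrix (Fin 2) ℤ M.det =>
      (b : ℚ)⁻¹ • (r.1).map (Int.cast : ℤ → ℚ)) '' FixedDetMatrices.reps M.det)).Finite :=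
    ((Set.toFinite (FixedDetMatrices.reps M.det)).image _).preimage hφ.injOn
  refine ⟨hfin.toFinset, fun γ => ?_⟩
  obtain ⟨δ, r, hr, hA⟩ := hred ⟨M * γ.1, by rw [Matrix.det_mul, γ.2, mul_one]⟩
  refine ⟨δ, (ofSL δ)⁻¹ * (s * ofSL γ), ?_, by group⟩
  rw [Set.Finite.mem_toFinset]
  refine ⟨r, hr, ?_⟩
  have hA' : M * γ.1 = δ.1 * r.1 := congrArg Subtype.val hA
  have hA2 : (M * γ.1).map (Int.cast : ℤ → ℚ) = (δ.1 * r.1).map (Int.cast : ℤ → ℚ) := by rw [hA']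
  have e1 : ∀ U V : Matrix (Fin 2) (Fin 2) ℤ, (U * V).map (Int.cast : ℤ → ℚ) =
      U.map (Int.cast : ℤ → ℚ) * V.map (Int.cast : ℤ → ℚ) := fun U V =>
    map_mul ((Int.castRingHom ℚ).mapMatrix) U V
  rw [e1, e1, hMs] at hA2
  rw [← map_inv, hφm, hφm]
  have e2 : φ (ofSL δ⁻¹) * φ (ofSL δ) = 1 := by
    rw [← hφm, ← map_mul]; simp [φ]
  have e3 : φ s * φ (ofSL γ) = (b : ℚ)⁻¹ • (φ (ofSL δ) * (r.1).map (Int.cast : ℤ → ℚ)) := by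
    rw [hφγ, hφγ, ← hA2, Matrix.smul_mul, inv_smul_smul₀ hb0]
  change (b : ℚ)⁻¹ • (r.1).map (Int.cast : ℤ → ℚ) = _
  rw [e3, Matrix.mul_smul, ← mul_assoc, e2, one_mul]

lemma exists_reps_finset (S : Finset GQ) :
    ∃ T : Finset GQ, ∀ s ∈ S, ∀ γ : SL(2, ℤ), ∃ δ : SL(2, ℤ), ∃ t ∈ T,
      s * ofSL γ = ofSL δ * t := by
  classical
  choose T hT using exists_reps
  refine ⟨S.biUnion T, fun s hs γ => ?_⟩
  obtain ⟨δ, t, ht, e⟩ := hT s γ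
  exact ⟨δ, t, Finset.mem_biUnion.2 ⟨s, hs, ht⟩, e⟩

/-- Two elements of `GL₂⁺(ℚ)` are equivalent when they have the same class in `Γ \ GL₂⁺(ℚ)`. -/
def leftRel : Setoid GQ where
  r g h := ∃ γ : SL(2, ℤ), h = ofSL γ * g
  iseqv := by
    refine ⟨fun g => ⟨1, by simp⟩, ?_, ?_⟩
    · rintro g h ⟨γ, rfl⟩
      exact ⟨γ⁻¹, by simp⟩
    · rintro g h k ⟨γ, rfl⟩ ⟨δ, rfl⟩
      exact ⟨δ * γ, by rw [map_mul, mul_assoc]⟩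

lemma exists_distinct (T : Finset GQ) : ∃ T' : Finset GQ,
    (∀ g, (∃ t ∈ T, leftRel t g) → ∃ t ∈ T', leftRel t g) ∧
    ∀ t ∈ T', ∀ t' ∈ T', leftRel t t' → t = t' := by
  classical
  refine ⟨T.image fun t => (Quotient.mk leftRel t).out, ?_, ?_⟩
  · rintro g ⟨t, ht, h⟩
    exact ⟨_, Finset.mem_image_of_mem _ ht,
      leftRel.trans (Quotient.mk_out (s := leftRel) t) h⟩
  · intro t ht t' ht' h
    obtain ⟨a, _, rfl⟩ := Finset.mem_image.1 ht
    obtain ⟨b, _, rfl⟩ := Finset.mem_image.1 ht'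
    have : Quotient.mk leftRel (Quotient.mk leftRel a).out =
      Quotient.mk leftRel (Quotient.mk leftRel b).out := Quotient.sound h
    rw [Quotient.out_eq, Quotient.out_eq] at this
    rw [this]

lemma exists_support (f : C_c(Z, ℂ)) : ∃ (S : Finset GQ) (L : Set Y), IsCompact L ∧
    ∀ z, f z ≠ 0 → ∃ s ∈ S, ∃ y ∈ L, ∃ h : InM2 s y.1, z = mk s y h := by
  have hK : IsCompact (tsupport f) := f.hasCompactSupport
  have hloc : ∀ z : Z, ∃ C : Set D, IsCompact C ∧ (Quotient.mk _ : D → Z) '' C ∈ 𝓝 z := by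
    intro z
    obtain ⟨x, rfl⟩ := Quotient.exists_rep z
    obtain ⟨C, hC, hx⟩ := exists_compact_mem_nhds x
    exact ⟨C, hC, isOpenMap_mk.image_mem_nhds hx⟩
  choose C hC hCz using hloc
  obtain ⟨t, -, ht⟩ := hK.elim_nhds_subcover (fun z => (Quotient.mk _ : D → Z) '' C z)
    fun z _ => hCz z
  have hU : IsCompact (⋃ z ∈ t, C z) := t.isCompact_biUnion fun z _ => hC z
  have h1 := (hU.image (f := fun x : D => x.1.1)
    (continuous_fst.comp continuous_subtype_val)).finite_of_discrete
  refine ⟨h1.toFinset, (fun x : D => x.1.2) '' (⋃ z ∈ t, C z), hU.image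
    (continuous_snd.comp continuous_subtype_val), fun z hz => ?_⟩
  have := ht (subset_tsupport _ hz)
  simp only [Set.mem_iUnion] at this
  obtain ⟨w, hw, x, hx, rfl⟩ := this
  have hx' : x ∈ ⋃ z ∈ t, C z := Set.mem_biUnion hw hx
  exact ⟨x.1.1, h1.mem_toFinset.2 ⟨x, hx', rfl⟩, x.1.2, ⟨x, hx', rfl⟩, x.2, rfl⟩

lemma hasCompactSupport_of {F : Z → ℂ} (S : Finset GQ) (L : Set Y) (hL : IsCompact L)
    (h : ∀ z, F z ≠ 0 → ∃ s ∈ S, ∃ y ∈ L, ∃ h : InM2 s y.1, z = mk s y h) :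
    HasCompactSupport F := by
  have hc : IsCompact ((Subtype.val : D → GQ × Y) ⁻¹' ((S : Set GQ) ×ˢ L)) :=
    isClopen_D.isClosed.isClosedEmbedding_subtypeVal.isCompact_preimage
      (S.finite_toSet.isCompact.prod hL)
  refine HasCompactSupport.intro (hc.image continuous_mk) fun z hz => ?_
  by_contra hne
  obtain ⟨s, hs, y, hy, h', rfl⟩ := h z hne
  exact hz ⟨⟨(s, y), h'⟩, ⟨hs, hy⟩, rfl⟩

lemma mk_eq_iff {g g' : GQ} {y y' : Y} {h : InM2 g y.1} {h' : InM2 g' y'.1} :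
    mk g y h = mk g' y' h' ↔ ∃ a b : SL(2, ℤ), g = ofSL a * g' * (ofSL b)⁻¹ ∧ y = b • y' := by
  constructor
  · intro e
    obtain ⟨⟨a, b⟩, hab⟩ := Quotient.exact e
    exact ⟨a, b, (congrArg (fun x : D => x.1.1) hab).symm, (congrArg (fun x : D => x.1.2) hab).symm⟩
  · rintro ⟨a, b, e1, e2⟩
    exact mk_eq a b e1 e2 _ _

/-- The support of an element of `C_c(Z)` only involves finitely many classes of `Γ \ GL₂⁺(ℚ)`. -/
lemma exists_finset (f : C_c(Z, ℂ)) : ∃ T : Finset GQ, ∀ g y h, f (mk g y h) ≠ 0 →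
    (∃ t ∈ T, leftRel t g) ∧ (∃ t ∈ T, leftRel t g⁻¹) := by
  classical
  obtain ⟨S, L, -, hf⟩ := exists_support f
  obtain ⟨T, hT⟩ := exists_reps_finset S
  obtain ⟨T', hT'⟩ := exists_reps_finset (S.image fun s => s⁻¹)
  refine ⟨T ∪ T', fun g y h hne => ?_⟩
  obtain ⟨s, hs, y', hy', h', e⟩ := hf _ hne
  obtain ⟨a, b, rfl, rfl⟩ := mk_eq_iff.1 e
  constructor
  · obtain ⟨δ, t, ht, e⟩ := hT s hs b⁻¹
    refine ⟨t, Finset.mem_union_left _ ht, a * δ, ?_⟩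
    rw [mul_assoc, ← map_inv, e, map_mul, mul_assoc]
  · obtain ⟨δ, t, ht, e⟩ := hT' s⁻¹ (Finset.mem_image_of_mem _ hs) a⁻¹
    refine ⟨t, Finset.mem_union_right _ ht, b * δ, ?_⟩
    rw [map_mul, mul_assoc (ofSL b), ← e]
    simp [mul_assoc]

/-! ### The convolution algebra -/

/-- The set `G_y` of the `g ∈ GL₂⁺(ℚ)` with `g y ∈ Y`. -/
abbrev Gy (y : Y) : Type := {g : GQ // InM2 g y.1}

/-- The equivalence relation on `G_y` given by left multiplication by elements of `Γ`. -/
instance cosetRel (y : Y) : Setoid (Gy y) := leftRel.comap Subtype.val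

/-- The quotient `Γ \ G_y`. -/
abbrev Coset (y : Y) : Type := Quotient (cosetRel y)

/-- The class in `Γ \ G_y` of an element `g` of `G_y`. -/
def cls (y : Y) (g : GQ) (h : InM2 g y.1) : Coset y := Quotient.mk _ ⟨g, h⟩

/-- The class of `1` in `Γ \ G_y`. -/
def clsOne (y : Y) : Coset y := cls y 1 (inM2_one _)

lemma cls_eq {y : Y} {g g' : GQ} {h : InM2 g y.1} {h' : InM2 g' y.1} :
    cls y g h = cls y g' h' ↔ leftRel g g' :=
  Quotient.eq (r := cosetRel y)

lemma coset_ind {y : Y} {p : Coset y → Prop} (h : ∀ g hg, p (cls y g hg)) (i : Coset y) : p i :=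
  Quotient.ind (fun g => h g.1 g.2) i

lemma inM2_pt {y : Y} {g h : GQ} (hg : InM2 g y.1) (hh : InM2 h y.1) :
    InM2 (g * h⁻¹) (act h y hh).1 := by
  refine (inM2_mul_act hh).1 ?_
  simpa using hg

/-- The point `(g h⁻¹, h y)` of `Z`, for two classes of elements `g, h` of `G_y`. -/
def pt (y : Y) : Coset y → Coset y → Z :=
  Quotient.lift₂ (fun g h : Gy y => mk (g.1 * h.1⁻¹) (act h.1 y h.2) (inM2_pt g.2 h.2)) (by
    rintro ⟨g, hg⟩ ⟨h, hh⟩ ⟨g', hg'⟩ ⟨h', hh'⟩ ⟨a, ha⟩ ⟨b, hb⟩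
    change g' = _ at ha
    change h' = _ at hb
    subst ha hb
    refine (mk_eq a b ?_ ?_ _ _).symm
    · simp [mul_assoc]
    · change act _ y hh' = _
      rw [← act_mul hh (inM2_ofSL _ _), act_ofSL])

lemma pt_cls (y : Y) (g h : GQ) (hg : InM2 g y.1) (hh : InM2 h y.1) :
    pt y (cls y g hg) (cls y h hh) = mk (g * h⁻¹) (act h y hh) (inM2_pt hg hh) := rfl

lemma pt_clsOne (y : Y) (g : GQ) (hg : InM2 g y.1) :
    pt y (cls y g hg) (clsOne y) = mk g y hg := by
  rw [clsOne, pt_cls]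
  exact mk_congr (by simp) (act_one _ _) _ _

lemma inM2_shift {y y' : Y} {h : GQ} {hh : InM2 h y.1} (e : y' = act h y hh) {k : GQ} :
    InM2 k y'.1 ↔ InM2 (k * h) y.1 := by
  subst e
  exact (inM2_mul_act hh).symm

/-- Right multiplication by `h`, from `Γ \ G_{h y}` to `Γ \ G_y`. -/
def shift {y y' : Y} {h : GQ} {hh : InM2 h y.1} (e : y' = act h y hh) : Coset y' ≃ Coset y where
  toFun := Quotient.lift (fun k : Gy y' => cls y (k.1 * h) ((inM2_shift e).1 k.2)) (by
    rintro ⟨a, ha⟩ ⟨b, hb⟩ ⟨γ, hγ⟩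
    exact cls_eq.2 ⟨γ, by rw [← mul_assoc]; exact congrArg (· * h) hγ⟩)
  invFun := Quotient.lift (fun k : Gy y => cls y' (k.1 * h⁻¹)
      ((inM2_shift e).2 (by simpa using k.2))) (by
    rintro ⟨a, ha⟩ ⟨b, hb⟩ ⟨γ, hγ⟩
    exact cls_eq.2 ⟨γ, by rw [← mul_assoc]; exact congrArg (· * h⁻¹) hγ⟩)
  left_inv := by
    refine coset_ind fun g hg => ?_
    exact cls_eq.2 ⟨1, by simp⟩
  right_inv := by
    refine coset_ind fun g hg => ?_
    exact cls_eq.2 ⟨1, by simp⟩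

lemma shift_cls {y y' : Y} {h : GQ} {hh : InM2 h y.1} (e : y' = act h y hh) (k : GQ)
    (hk : InM2 k y'.1) : shift e (cls y' k hk) = cls y (k * h) ((inM2_shift e).1 hk) := rfl

lemma shift_clsOne {y y' : Y} {h : GQ} {hh : InM2 h y.1} (e : y' = act h y hh) :
    shift e (clsOne y') = cls y h hh := by
  rw [clsOne, shift_cls]
  exact cls_eq.2 ⟨1, by simp⟩

lemma pt_shift {y y' : Y} {h : GQ} {hh : InM2 h y.1} (e : y' = act h y hh) (i j : Coset y') :
    pt y (shift e i) (shift e j) = pt y' i j := by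
  revert i j
  refine coset_ind fun g hg => coset_ind fun k hk => ?_
  rw [shift_cls, shift_cls, pt_cls, pt_cls]
  subst e
  refine mk_congr (by group) ?_ _ _
  rw [act_mul]

/-- The convolution `(f₁ * f₂)(g, y) = ∑ f₁(g h⁻¹, h y) f₂(h, y)`, summed over `h` in `Γ \ G_y`,
of two functions on `Z`. -/
def convFun (f₁ f₂ : Z → ℂ) : Z → ℂ :=
  Quotient.lift (fun x : D => ∑' j : Coset x.1.2,
    f₁ (pt x.1.2 (cls x.1.2 x.1.1 x.2) j) * f₂ (pt x.1.2 j (clsOne x.1.2))) (by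
  rintro x' x ⟨⟨a, b⟩, rfl⟩
  have e : ((a, b) • x : D).1.2 = act (ofSL b) x.1.2 (inM2_ofSL _ _) := (act_ofSL _ _ _).symm
  change (∑' j : Coset ((a, b) • x : D).1.2, _) = _
  rw [← (shift e).tsum_eq]
  refine tsum_congr fun j => ?_
  have e1 : cls x.1.2 x.1.1 x.2 = shift e (cls _ ((a, b) • x : D).1.1 ((a, b) • x : D).2) := by
    rw [shift_cls]
    exact cls_eq.2 ⟨a, by simp [smul_D_fst, mul_assoc]⟩
  have e2 : clsOne x.1.2 = shift e (clsOne _) := by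
    rw [shift_clsOne]
    exact cls_eq.2 ⟨b, by simp⟩
  rw [e1, e2, pt_shift, pt_shift])

lemma convFun_mk (f₁ f₂ : Z → ℂ) (g : GQ) (y : Y) (h : InM2 g y.1) :
    convFun f₁ f₂ (mk g y h) =
      ∑' j : Coset y, f₁ (pt y (cls y g h) j) * f₂ (pt y j (clsOne y)) := rfl

lemma convFun_pt (f₁ f₂ : Z → ℂ) (y : Y) (i l : Coset y) :
    convFun f₁ f₂ (pt y i l) = ∑' j : Coset y, f₁ (pt y i j) * f₂ (pt y j l) := by
  revert i l
  refine coset_ind fun g hg => coset_ind fun h hh => ?_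
  have e : act h y hh = act h y hh := rfl
  rw [pt_cls, convFun_mk, ← (shift e).tsum_eq]
  refine tsum_congr fun j => ?_
  rw [← shift_clsOne e, pt_shift]
  have : cls y g hg = shift e (cls _ (g * h⁻¹) (inM2_pt hg hh)) := by
    rw [shift_cls]
    exact cls_eq.2 ⟨1, by simp⟩
  rw [this, pt_shift]

/-- The involution `(g, y) ↦ (g⁻¹, g y)` of `Z`. -/
def invZ : Z → Z :=
  Quotient.lift (fun x : D => mk x.1.1⁻¹ (act x.1.1 x.1.2 x.2) (inM2_inv_act x.2)) (by
    rintro x' x ⟨⟨a, b⟩, rfl⟩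
    refine mk_eq b a ?_ ?_ _ _
    · change (ofSL a * x.1.1 * (ofSL b)⁻¹)⁻¹ = _
      simp [mul_assoc]
    · rw [← act_ofSL a _ (inM2_ofSL _ _)]
      have h1 : InM2 (ofSL a * x.1.1) x.1.2.1 := inM2_ofSL_act a x.2
      rw [act_mul (hgh := h1)]
      have e : ((a, b) • x : D).1.2 = act (ofSL b) x.1.2 (inM2_ofSL _ _) := (act_ofSL _ _ _).symm
      rw [act_congr rfl e _ (e ▸ ((a, b) • x : D).2), act_mul (hgh := by simpa [smul_D_fst] using h1)]
      exact act_congr (by simp [smul_D_fst]) rfl _ _)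

lemma invZ_mk (y : Y) (g : GQ) (h : InM2 g y.1) :
    invZ (mk g y h) = mk g⁻¹ (act g y h) (inM2_inv_act h) := rfl

lemma invZ_pt (y : Y) (i j : Coset y) : invZ (pt y i j) = pt y j i := by
  revert i j
  refine coset_ind fun g hg => coset_ind fun h hh => ?_
  rw [pt_cls, pt_cls, invZ_mk]
  have e1 : (g * h⁻¹)⁻¹ = h * g⁻¹ := by rw [_root_.mul_inv_rev, inv_inv]
  have h2 : InM2 (g * h⁻¹ * h) y.1 := by rw [inv_mul_cancel_right]; exact hg
  have e2 : act (g * h⁻¹) (act h y hh) (inM2_pt hg hh) = act g y hg := by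
    rw [act_mul (hgh := h2)]
    exact act_congr (inv_mul_cancel_right _ _) rfl h2 hg
  exact mk_congr e1 e2 _ _

lemma invZ_invZ (z : Z) : invZ (invZ z) = z := by
  induction z using Quotient.ind with
  | _ x =>
    change invZ (invZ (mk x.1.1 x.1.2 x.2)) = mk x.1.1 x.1.2 x.2
    rw [← pt_clsOne, invZ_pt, invZ_pt]

/-! ### Operators given by kernels -/

/-- The Hilbert space `ℓ²(ι)`. -/
abbrev L2 (ι : Type) : Type := lp (fun _ : ι => ℂ) 2

/-- Bounded kernels with at most `N` non-zero entries in each row and each column. -/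
structure IsFinKernel {ι : Type} (C : ℝ) (N : ℕ) (k : ι → ι → ℂ) : Prop where
  bound : ∀ i j, ‖k i j‖ ≤ C
  row : ∀ i, ∃ s : Finset ι, s.card ≤ N ∧ ∀ j, k i j ≠ 0 → j ∈ s
  col : ∀ j, ∃ s : Finset ι, s.card ≤ N ∧ ∀ i, k i j ≠ 0 → i ∈ s

lemma IsFinKernel.summable {ι : Type} {C : ℝ} {N : ℕ} {k : ι → ι → ℂ} (h : IsFinKernel C N k)
    (ξ : ι → ℂ) (i : ι) : Summable fun j => k i j * ξ j := by
  obtain ⟨s, -, hs⟩ := h.row i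
  refine summable_of_ne_finset_zero (s := s) fun j hj => ?_
  rw [not_not.1 fun h' => hj (hs j h'), zero_mul]

lemma IsFinKernel.sum_le {ι : Type} {C : ℝ} {N : ℕ} {k : ι → ι → ℂ} (h : IsFinKernel C N k)
    (ξ : L2 ι) (s : Finset ι) :
    ∑ i ∈ s, ‖∑' j, k i j * ξ j‖ ^ (2 : ENNReal).toReal ≤ (C * N * ‖ξ‖) ^ (2 : ENNReal).toReal := by
  classical
  have hξ : ∀ u : Finset ι, ∑ j ∈ u, ‖ξ j‖ ^ 2 ≤ ‖ξ‖ ^ 2 := by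
    intro u
    have := lp.sum_rpow_le_norm_rpow (p := 2) (by simp) ξ u
    simpa using this
  simp only [ENNReal.toReal_ofNat, Real.rpow_ofNat]
  choose r hr hr' using h.row
  choose c hc hc' using h.col
  let R : ι → Finset ι := fun i => (r i).filter fun j => k i j ≠ 0
  have hR : ∀ i j, j ∈ R i ↔ k i j ≠ 0 := fun i j => by
    simp only [R, Finset.mem_filter, and_iff_right_iff_imp]
    exact hr' i j
  have hRc : ∀ i, (R i).card ≤ N := fun i => (Finset.card_filter_le _ _).trans (hr i)
  have e1 : ∀ i, ‖∑' j, k i j * ξ j‖ ^ 2 ≤ N * C ^ 2 * ∑ j ∈ R i, ‖ξ j‖ ^ 2 := by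
    intro i
    rw [tsum_eq_sum (s := R i) fun j hj => by
      rw [not_not.1 fun h' => hj ((hR i j).2 h'), zero_mul]]
    have a1 : ‖∑ j ∈ R i, k i j * ξ j‖ ≤ ∑ j ∈ R i, C * ‖ξ j‖ := by
      refine (norm_sum_le _ _).trans (Finset.sum_le_sum fun j _ => ?_)
      rw [norm_mul]
      exact mul_le_mul_of_nonneg_right (h.bound i j) (norm_nonneg _)
    have a2 : (∑ j ∈ R i, C * ‖ξ j‖) ^ 2 ≤ (R i).card * ∑ j ∈ R i, (C * ‖ξ j‖) ^ 2 :=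
      sq_sum_le_card_mul_sum_sq
    have a3 : ((R i).card : ℝ) ≤ N := by exact_mod_cast hRc i
    calc ‖∑ j ∈ R i, k i j * ξ j‖ ^ 2 ≤ (∑ j ∈ R i, C * ‖ξ j‖) ^ 2 := by gcongr
      _ ≤ _ := a2
      _ ≤ N * ∑ j ∈ R i, (C * ‖ξ j‖) ^ 2 := by gcongr
      _ = _ := by
        simp only [mul_pow, ← Finset.mul_sum]
        ring
  have e2 : ∑ i ∈ s, ∑ j ∈ R i, ‖ξ j‖ ^ 2 ≤ N * ‖ξ‖ ^ 2 := by
    have b1 : ∑ i ∈ s, ∑ j ∈ R i, ‖ξ j‖ ^ 2 =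
        ∑ j ∈ s.biUnion R, ∑ i ∈ s.filter (fun i => k i j ≠ 0), ‖ξ j‖ ^ 2 := by
      refine Finset.sum_comm' fun i j => ?_
      simp only [hR, Finset.mem_filter, Finset.mem_biUnion]
      constructor
      · rintro ⟨h1, h2⟩
        exact ⟨⟨h1, h2⟩, i, h1, h2⟩
      · exact fun h => h.1
    have b2 : ∀ j, ((s.filter (fun i => k i j ≠ 0)).card : ℝ) ≤ N := fun j => by
      have : (s.filter (fun i => k i j ≠ 0)).card ≤ (c j).card :=
        Finset.card_le_card fun i hi => hc' j i (Finset.mem_filter.1 hi).2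
      exact_mod_cast this.trans (hc j)
    rw [b1]
    calc _ ≤ ∑ j ∈ s.biUnion R, N * ‖ξ j‖ ^ 2 := by
          refine Finset.sum_le_sum fun j _ => ?_
          rw [Finset.sum_const, nsmul_eq_mul]
          exact mul_le_mul_of_nonneg_right (b2 j) (by positivity)
      _ = N * ∑ j ∈ s.biUnion R, ‖ξ j‖ ^ 2 := by rw [Finset.mul_sum]
      _ ≤ _ := by gcongr; exact hξ _
  calc ∑ i ∈ s, ‖∑' j, k i j * ξ j‖ ^ 2 ≤ ∑ i ∈ s, N * C ^ 2 * ∑ j ∈ R i, ‖ξ j‖ ^ 2 :=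
        Finset.sum_le_sum fun i _ => e1 i
    _ = N * C ^ 2 * ∑ i ∈ s, ∑ j ∈ R i, ‖ξ j‖ ^ 2 := by rw [Finset.mul_sum]
    _ ≤ N * C ^ 2 * (N * ‖ξ‖ ^ 2) := by gcongr
    _ = (C * N * ‖ξ‖) ^ 2 := by ring

lemma exists_op {ι : Type} {k : ι → ι → ℂ} (h : ∃ C N, 0 ≤ C ∧ IsFinKernel C N k) :
    ∃ T : L2 ι →L[ℂ] L2 ι, ∀ ξ i, T ξ i = ∑' j, k i j * ξ j := by
  obtain ⟨C, N, hC, h⟩ := h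
  let T : L2 ι →ₗ[ℂ] L2 ι :=
    { toFun := fun ξ => ⟨fun i => ∑' j, k i j * ξ j, memℓp_gen' (h.sum_le ξ)⟩
      map_add' := fun ξ η => by
        ext i
        change ∑' j, k i j * (ξ + η) j = ∑' j, k i j * ξ j + ∑' j, k i j * η j
        rw [← (h.summable ξ i).tsum_add (h.summable η i)]
        exact tsum_congr fun j => mul_add _ _ _
      map_smul' := fun c ξ => by
        ext i
        change ∑' j, k i j * (c • ξ) j = c * ∑' j, k i j * ξ j
        rw [← tsum_mul_left]
        exact tsum_congr fun j => mul_left_comm _ _ _ }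
  exact ⟨T.mkContinuous (C * N) fun ξ => lp.norm_le_of_forall_sum_le (by simp) (by positivity)
    (h.sum_le ξ), fun ξ i => rfl⟩

lemma norm_op_le {ι : Type} {k : ι → ι → ℂ} {C : ℝ} {N : ℕ} (hC : 0 ≤ C) (h : IsFinKernel C N k)
    {T : L2 ι →L[ℂ] L2 ι} (hT : ∀ ξ i, T ξ i = ∑' j, k i j * ξ j) : ‖T‖ ≤ C * N := by
  refine T.opNorm_le_bound (by positivity) fun ξ =>
    lp.norm_le_of_forall_sum_le (by simp) (by positivity) fun s => ?_
  simp only [hT]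
  exact h.sum_le ξ s

lemma op_ext {ι : Type} {S T : L2 ι →L[ℂ] L2 ι} [DecidableEq ι]
    (h : ∀ i j, S (lp.single 2 j (1 : ℂ)) i = T (lp.single 2 j (1 : ℂ)) i) : S = T := by
  refine lp.ext_continuousLinearMap (by simp) fun j => ?_
  ext i
  simpa using h i j

lemma op_single {ι : Type} [DecidableEq ι] {k : ι → ι → ℂ} {T : L2 ι →L[ℂ] L2 ι}
    (hT : ∀ ξ i, T ξ i = ∑' j, k i j * ξ j) (i j : ι) : T (lp.single 2 j (1 : ℂ)) i = k i j := by
  rw [hT, tsum_eq_single j fun l hl => by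
    rw [lp.single_apply_ne (E := fun _ : ι => ℂ) 2 j (1 : ℂ) hl, mul_zero],
    lp.single_apply_self, mul_one]

lemma star_op_single {ι : Type} [DecidableEq ι] {k : ι → ι → ℂ} {T : L2 ι →L[ℂ] L2 ι}
    (hT : ∀ ξ i, T ξ i = ∑' j, k i j * ξ j) (i j : ι) :
    star T (lp.single 2 j (1 : ℂ)) i = star (k j i) := by
  have h1 : inner ℂ (lp.single 2 i (1 : ℂ) : L2 ι) (star T (lp.single 2 j (1 : ℂ))) =
      star T (lp.single 2 j (1 : ℂ)) i := by
    rw [lp.inner_single_left]; simp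
  rw [← h1, ContinuousLinearMap.star_eq_adjoint, ContinuousLinearMap.adjoint_inner_right,
    lp.inner_single_right, op_single hT]
  simp

/-! ### The involutive algebra `C_c(Z)` -/

lemma continuous_D {W : Type*} [TopologicalSpace W] {F : D → W}
    (h : ∀ g, Continuous fun y : {y : Y // InM2 g y.1} => F ⟨(g, y.1), y.2⟩) : Continuous F := by
  rw [continuous_iff_continuousAt]
  rintro ⟨⟨g, y⟩, hy⟩
  have hU : IsOpen {x : D | x.1.1 = g} :=
    (isOpen_discrete {g}).preimage (continuous_fst.comp continuous_subtype_val)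
  refine ContinuousOn.continuousAt (s := {x : D | x.1.1 = g}) ?_ (hU.mem_nhds rfl)
  rw [continuousOn_iff_continuous_domRestrict]
  have hx' : ∀ x : D, x.1.1 = g → InM2 g x.1.2.1 := fun x hx => hx ▸ x.2
  have hm : Continuous fun x : {x : D | x.1.1 = g} =>
      (⟨x.1.1.2, hx' x.1 x.2⟩ : {y : Y // InM2 g y.1}) :=
    Continuous.subtype_mk (continuous_snd.comp
      (continuous_subtype_val.comp continuous_subtype_val)) _
  have e : Set.domRestrict {x : D | x.1.1 = g} F =
      (fun y : {y : Y // InM2 g y.1} => F ⟨(g, y.1), y.2⟩) ∘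
        fun x : {x : D | x.1.1 = g} => (⟨x.1.1.2, hx' x.1 x.2⟩ : {y : Y // InM2 g y.1}) := by
    funext ⟨⟨⟨g', y'⟩, h'⟩, hg⟩
    change g' = g at hg
    subst hg
    rfl
  rw [e]
  exact (h g).comp hm

lemma continuous_mk_left (g : GQ) :
    Continuous fun y : {y : Y // InM2 g y.1} => mk g y.1 y.2 :=
  continuous_mk.comp (Continuous.subtype_mk (continuous_const.prodMk continuous_subtype_val) _)

lemma continuous_mk_act (g k : GQ) (h : ∀ y : {y : Y // InM2 g y.1}, InM2 k (act g y.1 y.2).1) :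
    Continuous fun y : {y : Y // InM2 g y.1} => mk k (act g y.1 y.2) (h y) :=
  continuous_mk.comp (Continuous.subtype_mk (continuous_const.prodMk (continuous_act g)) _)

lemma continuous_invZ : Continuous invZ := by
  refine Continuous.quotient_lift ?_ _
  exact continuous_D fun g => continuous_mk_act g g⁻¹ fun y => inM2_inv_act y.2

/-- The homeomorphism `(g, y) ↦ (g⁻¹, g y)` of `Z`. -/
def invHomeo : Z ≃ₜ Z where
  toFun := invZ
  invFun := invZ
  left_inv := invZ_invZ
  right_inv := invZ_invZ
  continuous_toFun := continuous_invZ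
  continuous_invFun := continuous_invZ

/-- The space `𝒜 = C_c(Z)`; its product is the convolution `conv`, and its involution is `invol`. -/
abbrev 𝒜 : Type := C_c(Z, ℂ)

/-- The involution `f*(g, y) = conj (f (g⁻¹, g y))` of `𝒜`. -/
def invol (f : 𝒜) : 𝒜 where
  toFun z := star (f (invZ z))
  continuous_toFun := continuous_star.comp (f.continuous.comp continuous_invZ)
  hasCompactSupport' :=
    (f.hasCompactSupport.comp_homeomorph invHomeo).comp_left (g := fun w : ℂ => star w) (star_zero _)

open Classical in
/-- The term of the convolution at the class of `t`. -/
def convTerm (f₁ f₂ : Z → ℂ) (t : GQ) (x : D) : ℂ :=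
  if ht : InM2 t x.1.2.1 then
    f₁ (pt x.1.2 (cls x.1.2 x.1.1 x.2) (cls x.1.2 t ht)) * f₂ (pt x.1.2 (cls x.1.2 t ht) (clsOne _))
  else 0

lemma tsum_coset (T : Finset GQ) (hT : ∀ t ∈ T, ∀ t' ∈ T, leftRel t t' → t = t') (y : Y)
    (F : Coset y → ℂ) (hF : ∀ k hk, F (cls y k hk) ≠ 0 → ∃ t ∈ T, leftRel t k)
    (U : Finset GQ) (hU : ∀ t, t ∈ U ↔ t ∈ T ∧ InM2 t y.1) :
    ∑' j, F j = ∑ t ∈ U.attach, F (cls y t.1 ((hU t.1).1 t.2).2) := by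
  classical
  have hinj : ∀ a ∈ U.attach, ∀ b ∈ U.attach,
      cls y a.1 ((hU a.1).1 a.2).2 = cls y b.1 ((hU b.1).1 b.2).2 → a = b := fun a _ b _ hab =>
    Subtype.ext (hT _ ((hU a.1).1 a.2).1 _ ((hU b.1).1 b.2).1 (cls_eq.1 hab))
  rw [← Finset.sum_image (f := F) hinj]
  refine tsum_eq_sum (coset_ind fun k hk hnot => ?_)
  by_contra hne
  obtain ⟨t, ht, hrel⟩ := hF k hk hne
  have hty : InM2 t y.1 := by
    obtain ⟨γ, e⟩ := leftRel.symm hrel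
    rw [e]
    exact inM2_ofSL_act γ hk
  exact hnot (Finset.mem_image.2 ⟨⟨t, (hU t).2 ⟨ht, hty⟩⟩, Finset.mem_attach _ _, cls_eq.2 hrel⟩)

lemma conv_eq_sum (f₁ f₂ : 𝒜) : ∃ T : Finset GQ, ∀ x : D,
    (∑' j : Coset x.1.2, f₁ (pt x.1.2 (cls x.1.2 x.1.1 x.2) j) *
      f₂ (pt x.1.2 j (clsOne x.1.2))) = ∑ t ∈ T, convTerm f₁ f₂ t x := by
  classical
  obtain ⟨T₀, hT₀⟩ := exists_finset f₂
  obtain ⟨T, hT, hT'⟩ := exists_distinct T₀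
  refine ⟨T, fun x => ?_⟩
  rw [tsum_coset T hT' x.1.2 _ (fun k hk hne => ?_) (T.filter fun t => InM2 t x.1.2.1)
    (fun t => Finset.mem_filter)]
  · unfold convTerm
    rw [Finset.sum_dite, Finset.sum_const_zero, add_zero]
    exact Finset.sum_congr rfl fun _ _ => rfl
  · have h2 := right_ne_zero_of_mul hne
    rw [pt_clsOne] at h2
    exact hT k (hT₀ _ _ _ h2).1

lemma continuous_convTerm (f₁ f₂ : 𝒜) (t : GQ) : Continuous (convTerm f₁ f₂ t) := by
  have hU : IsClopen {x : D | InM2 t x.1.2.1} :=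
    (isClopen_inM2 t).preimage
      (continuous_fst.comp (continuous_snd.comp continuous_subtype_val))
  rw [continuous_iff_continuousAt]
  intro x
  by_cases hx : InM2 t x.1.2.1
  · refine ContinuousOn.continuousAt (s := {x : D | InM2 t x.1.2.1}) ?_ (hU.isOpen.mem_nhds hx)
    rw [continuousOn_iff_continuous_domRestrict]
    have c0 : Continuous fun x : {x : D | InM2 t x.1.2.1} =>
        (⟨x.1.1.2, x.2⟩ : {y : Y // InM2 t y.1}) :=
      Continuous.subtype_mk (continuous_snd.comp
        (continuous_subtype_val.comp continuous_subtype_val)) _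
    have c1 : Continuous fun x : {x : D | InM2 t x.1.2.1} => act t x.1.1.2 x.2 := by
      have := (continuous_act t).comp c0
      simp only [Function.comp_def] at this
      exact this
    have c2 : Continuous fun x : {x : D | InM2 t x.1.2.1} => x.1.1.1 * t⁻¹ :=
      (continuous_of_discreteTopology (f := fun g : GQ => g * t⁻¹)).comp
        (continuous_fst.comp (continuous_subtype_val.comp continuous_subtype_val))
    have c3 : Continuous fun x : {x : D | InM2 t x.1.2.1} =>
        mk (x.1.1.1 * t⁻¹) (act t x.1.1.2 x.2) (inM2_pt x.1.2 x.2) :=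
      continuous_mk.comp (Continuous.subtype_mk (c2.prodMk c1) _)
    have c4 : Continuous fun x : {x : D | InM2 t x.1.2.1} => mk t x.1.1.2 x.2 := by
      have := (continuous_mk_left t).comp c0
      simp only [Function.comp_def] at this
      exact this
    refine ((f₁.continuous.comp c3).mul (f₂.continuous.comp c4)).congr fun x => ?_
    have e : convTerm f₁ f₂ t x.1 = f₁ (pt x.1.1.2 (cls x.1.1.2 x.1.1.1 x.1.2) (cls x.1.1.2 t x.2)) *
        f₂ (pt x.1.1.2 (cls x.1.1.2 t x.2) (clsOne _)) := dif_pos x.2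
    rw [pt_clsOne, pt_cls] at e
    exact e.symm
  · refine ContinuousAt.congr (f := fun _ => 0) continuousAt_const ?_
    filter_upwards [hU.compl.isOpen.mem_nhds hx] with w hw
    have hw' : ¬ InM2 t w.1.2.1 := hw
    have e : convTerm f₁ f₂ t w = 0 := dif_neg hw'
    exact e.symm

/-- The convolution product `(f₁ * f₂)(g, y) = ∑ f₁(g h⁻¹, h y) f₂(h, y)` of `𝒜`. -/
def conv (f₁ f₂ : 𝒜) : 𝒜 where
  toFun := convFun f₁ f₂
  continuous_toFun := by
    classical
    obtain ⟨T, hT⟩ := conv_eq_sum f₁ f₂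
    refine Continuous.quotient_lift ?_ _
    exact (continuous_finsetSum T fun t _ => continuous_convTerm f₁ f₂ t).congr fun x => (hT x).symm
  hasCompactSupport' := by
    classical
    obtain ⟨T₁, hT₁⟩ := exists_finset f₁
    obtain ⟨S, L, hL, hS⟩ := exists_support f₂
    obtain ⟨U₀, hU₀⟩ := exists_reps_finset S
    obtain ⟨U, hU⟩ := exists_reps_finset (Finset.image₂ (· * ·) T₁ S)
    obtain ⟨V, hV⟩ := exists_reps_finset T₁
    obtain ⟨W, hW⟩ := exists_reps_finset (Finset.image₂ (· * ·) V S)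
    refine hasCompactSupport_of W L hL fun z hz => ?_
    obtain ⟨x, rfl⟩ := Quotient.exists_rep z
    have hz' : (∑' j : Coset x.1.2, f₁ (pt x.1.2 (cls x.1.2 x.1.1 x.2) j) *
      f₂ (pt x.1.2 j (clsOne x.1.2))) ≠ 0 := hz
    obtain ⟨j, hj⟩ : ∃ j : Coset x.1.2, f₁ (pt x.1.2 (cls x.1.2 x.1.1 x.2) j) *
      f₂ (pt x.1.2 j (clsOne x.1.2)) ≠ 0 := by
      by_contra hcon
      push Not at hcon
      exact hz' (by simp [hcon])
    obtain ⟨⟨k, hk⟩, rfl⟩ := Quotient.exists_rep j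
    change f₁ (pt x.1.2 (cls x.1.2 x.1.1 x.2) (cls x.1.2 k hk)) *
      f₂ (pt x.1.2 (cls x.1.2 k hk) (clsOne x.1.2)) ≠ 0 at hj
    have h1 := left_ne_zero_of_mul hj
    have h2 := right_ne_zero_of_mul hj
    rw [pt_clsOne] at h2
    rw [pt_cls] at h1
    obtain ⟨t, ht, c, hc⟩ := (hT₁ _ _ _ h1).1
    obtain ⟨s, hs, y, hy, hsy, e⟩ := hS _ h2
    obtain ⟨a, b, ek, ey⟩ := mk_eq_iff.1 e
    -- here `g k⁻¹ = c t`, `k = a s b⁻¹` and `x.2 = b y`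
    obtain ⟨d, v, hv, ed⟩ := hV t ht a
    obtain ⟨d', w, hw, ed'⟩ := hW (v * s) (Finset.mem_image₂_of_mem hv hs) 1
    have eg : x.1.1 = ofSL (c * d * d') * w * (ofSL b)⁻¹ := by
      have : x.1.1 = ofSL c * t * k := by rw [← hc]; simp
      rw [map_one, mul_one] at ed'
      rw [this, ek, map_mul, map_mul]
      calc ofSL c * t * (ofSL a * s * (ofSL b)⁻¹) = ofSL c * (t * ofSL a) * s * (ofSL b)⁻¹ := by
            simp [mul_assoc]
        _ = ofSL c * ofSL d * (v * s) * (ofSL b)⁻¹ := by rw [ed]; simp [mul_assoc]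
        _ = _ := by rw [ed']; simp [mul_assoc]
    have hwy : InM2 w y.1 := by
      have h3 := inM2_smul (c * d * d')⁻¹ b⁻¹ x.2
      rw [eg, ey] at h3
      have e4 : (b⁻¹ • (b • y).1 : M2R) = y.1 := inv_smul_smul b y.1
      rw [e4] at h3
      simpa [mul_assoc] using h3
    exact ⟨w, hw, y, hy, hwy, mk_eq_iff.2 ⟨_, _, eg, ey⟩⟩

/-! ### The representations `π_y` and the `C*`-algebra `A` -/

/-- The Hilbert space `ℓ²(Γ \ G_y)`. -/
abbrev Hy (y : Y) : Type := L2 (Coset y)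

lemma exists_coset_finset (T : Finset GQ) (y : Y) (g : GQ) :
    ∃ s : Finset (Coset y), s.card ≤ T.card ∧
      ∀ h hh, (∃ t ∈ T, leftRel t (h * g⁻¹)) → cls y h hh ∈ s := by
  classical
  refine ⟨((T.filter fun t => InM2 (t * g) y.1).attach).image fun t =>
    cls y (t.1 * g) (Finset.mem_filter (p := fun t => InM2 (t * g) y.1).1 t.2).2, ?_, ?_⟩
  · refine Finset.card_image_le.trans ?_
    rw [Finset.card_attach]
    exact Finset.card_filter_le _ _
  · rintro h hh ⟨t, ht, hrel⟩
    have hrel' : leftRel (t * g) h := by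
      obtain ⟨γ, e⟩ := hrel
      refine ⟨γ, ?_⟩
      rw [← mul_assoc, ← e]
      simp
    have hty : InM2 (t * g) y.1 := by
      obtain ⟨γ, e⟩ := leftRel.symm hrel'
      rw [e]
      exact inM2_ofSL_act γ hh
    exact Finset.mem_image.2 ⟨⟨t, Finset.mem_filter.2 ⟨ht, hty⟩⟩, Finset.mem_attach _ _,
      cls_eq.2 hrel'⟩

lemma exists_kernel_bound (f : 𝒜) : ∃ (C : ℝ) (N : ℕ), 0 ≤ C ∧
    ∀ y : Y, IsFinKernel C N fun i j : Coset y => f (pt y i j) := by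
  obtain ⟨C, hC⟩ := f.hasCompactSupport.exists_bound_of_continuous f.continuous
  obtain ⟨T, hT⟩ := exists_finset f
  refine ⟨max C 0, T.card, le_max_right _ _, fun y => ⟨fun i j => (hC _).trans (le_max_left _ _),
    coset_ind fun g hg => ?_, coset_ind fun g hg => ?_⟩⟩
  · obtain ⟨s, hs, hs'⟩ := exists_coset_finset T y g
    refine ⟨s, hs, coset_ind fun h hh hne => hs' h hh ?_⟩
    rw [pt_cls] at hne
    obtain ⟨t, ht, hrel⟩ := (hT _ _ _ hne).2
    exact ⟨t, ht, by simpa using hrel⟩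
  · obtain ⟨s, hs, hs'⟩ := exists_coset_finset T y g
    refine ⟨s, hs, coset_ind fun h hh hne => hs' h hh ?_⟩
    rw [pt_cls] at hne
    exact (hT _ _ _ hne).1

lemma exists_rep (f : 𝒜) (y : Y) :
    ∃ T : Hy y →L[ℂ] Hy y, ∀ ξ i, T ξ i = ∑' j, f (pt y i j) * ξ j := by
  obtain ⟨C, N, hC, h⟩ := exists_kernel_bound f
  exact exists_op ⟨C, N, hC, h y⟩

/-- The operator `π_y(f)` of `ℓ²(Γ \ G_y)`, given by
`(π_y(f) ξ)(g) = ∑ f(g h⁻¹, h y) ξ(h)`, summed over `h` in `Γ \ G_y`. -/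
def rep (f : 𝒜) (y : Y) : Hy y →L[ℂ] Hy y := Classical.choose (exists_rep f y)

lemma rep_apply (f : 𝒜) (y : Y) (ξ : Hy y) (i : Coset y) :
    rep f y ξ i = ∑' j, f (pt y i j) * ξ j :=
  Classical.choose_spec (exists_rep f y) ξ i

lemma exists_norm_rep_le (f : 𝒜) : ∃ M, ∀ y, ‖rep f y‖ ≤ M := by
  obtain ⟨C, N, hC, h⟩ := exists_kernel_bound f
  exact ⟨C * N, fun y => norm_op_le hC (h y) (rep_apply f y)⟩

lemma rep_single [∀ y, DecidableEq (Coset y)] (f : 𝒜) (y : Y) (i j : Coset y) :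
    rep f y (lp.single 2 j (1 : ℂ)) i = f (pt y i j) :=
  op_single (rep_apply f y) i j

lemma rep_eq {f : 𝒜} {y : Y} {T : Hy y →L[ℂ] Hy y} [∀ y, DecidableEq (Coset y)]
    (h : ∀ i j, T (lp.single 2 j (1 : ℂ)) i = f (pt y i j)) : T = rep f y :=
  op_ext fun i j => by rw [h, rep_single]

lemma rep_add (f₁ f₂ : 𝒜) (y : Y) : rep (f₁ + f₂) y = rep f₁ y + rep f₂ y := by
  classical
  refine (rep_eq fun i j => ?_).symm
  change rep f₁ y _ i + rep f₂ y _ i = _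
  rw [rep_single, rep_single]; rfl

lemma rep_smul (c : ℂ) (f : 𝒜) (y : Y) : rep (c • f) y = c • rep f y := by
  classical
  refine (rep_eq fun i j => ?_).symm
  change c * rep f y _ i = _
  rw [rep_single]; rfl

lemma rep_conv (f₁ f₂ : 𝒜) (y : Y) : rep (conv f₁ f₂) y = rep f₁ y * rep f₂ y := by
  classical
  refine (rep_eq fun i j => ?_).symm
  change rep f₁ y (rep f₂ y _) i = convFun f₁ f₂ (pt y i j)
  rw [rep_apply, convFun_pt]
  exact tsum_congr fun l => by rw [rep_single]

lemma rep_invol (f : 𝒜) (y : Y) : rep (invol f) y = star (rep f y) := by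
  classical
  refine (rep_eq fun i j => ?_).symm
  rw [star_op_single (rep_apply f y)]
  change _ = star (f (invZ (pt y i j)))
  rw [invZ_pt]

/-- The `C*`-algebra of all bounded families of operators on the spaces `ℓ²(Γ \ G_y)`, with the
norm `sup_y ‖T_y‖`. -/
def BigAlg : Type := lp (fun y : Y => Hy y →L[ℂ] Hy y) ∞

instance : NonUnitalCStarAlgebra BigAlg :=
  inferInstanceAs (NonUnitalCStarAlgebra (lp (fun y : Y => Hy y →L[ℂ] Hy y) ∞))

/-- The component at `y` of a bounded family of operators. -/
def BigAlg.fiber (b : BigAlg) (y : Y) : Hy y →L[ℂ] Hy y := b.1 y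

lemma BigAlg.ext {b c : BigAlg} (h : ∀ y, b.fiber y = c.fiber y) : b = c := Subtype.ext (funext h)

lemma BigAlg.mul_fiber (b c : BigAlg) (y : Y) : (b * c).fiber y = b.fiber y * c.fiber y := rfl

lemma BigAlg.star_fiber (b : BigAlg) (y : Y) : (star b).fiber y = star (b.fiber y) := rfl

lemma BigAlg.add_fiber (b c : BigAlg) (y : Y) : (b + c).fiber y = b.fiber y + c.fiber y := rfl

lemma BigAlg.smul_fiber (z : ℂ) (b : BigAlg) (y : Y) : (z • b).fiber y = z • b.fiber y := rfl

/-- A bounded family of operators, as an element of the `C*`-algebra of bounded families. -/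
def BigAlg.ofBounded (T : ∀ y, Hy y →L[ℂ] Hy y) (h : ∃ M, ∀ y, ‖T y‖ ≤ M) : BigAlg :=
  ⟨T, memℓp_infty (by
    obtain ⟨M, hM⟩ := h
    exact ⟨M, by rintro _ ⟨y, rfl⟩; exact hM y⟩)⟩

/-- The element `(π_y(f))_y`, of norm `sup_y ‖π_y(f)‖`, for `f` in `𝒜`. -/
def piAll (f : 𝒜) : BigAlg := BigAlg.ofBounded (rep f) (exists_norm_rep_le f)

lemma piAll_fiber (f : 𝒜) (y : Y) : (piAll f).fiber y = rep f y := rfl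

lemma piAll_add (f g : 𝒜) : piAll (f + g) = piAll f + piAll g :=
  BigAlg.ext fun y => rep_add f g y

lemma piAll_smul (c : ℂ) (f : 𝒜) : piAll (c • f) = c • piAll f :=
  BigAlg.ext fun y => rep_smul c f y

lemma piAll_conv (f₁ f₂ : 𝒜) : piAll (conv f₁ f₂) = piAll f₁ * piAll f₂ :=
  BigAlg.ext fun y => rep_conv f₁ f₂ y

lemma piAll_invol (f : 𝒜) : piAll (invol f) = star (piAll f) :=
  BigAlg.ext fun y => rep_invol f y

/-- The image of the involutive algebra `𝒜`. -/
def A0 : NonUnitalStarSubalgebra ℂ BigAlg where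
  carrier := Set.range piAll
  add_mem' := by
    rintro _ _ ⟨f, rfl⟩ ⟨g, rfl⟩
    exact ⟨f + g, piAll_add f g⟩
  zero_mem' := ⟨(0 : ℂ) • 0, by rw [piAll_smul, zero_smul]⟩
  mul_mem' := by
    rintro _ _ ⟨f, rfl⟩ ⟨g, rfl⟩
    exact ⟨conv f g, piAll_conv f g⟩
  smul_mem' := by
    rintro c _ ⟨f, rfl⟩
    exact ⟨c • f, piAll_smul c f⟩
  star_mem' := by
    rintro _ ⟨f, rfl⟩
    exact ⟨invol f, piAll_invol f⟩

/-- The `C*`-algebra of the `GL₂`-system, the completion of `𝒜` for the norm `sup_y ‖π_y(f)‖`,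
realized as the closure of the image of `𝒜` in the `C*`-algebra of bounded families. -/
def ASub : NonUnitalStarSubalgebra ℂ BigAlg := A0.topologicalClosure

instance isClosed_ASub : IsClosed (ASub : Set BigAlg) :=
  NonUnitalStarSubalgebra.isClosed_topologicalClosure A0

/-- The `C*`-algebra `A` of the `GL₂`-system. -/
abbrev A : Type := ASub

/-- The canonical map `𝒜 → A`. -/
def toA (f : 𝒜) : A := ⟨piAll f, NonUnitalStarSubalgebra.le_topologicalClosure A0 ⟨f, rfl⟩⟩


lemma toA_conv (f₁ f₂ : 𝒜) : toA (conv f₁ f₂) = toA f₁ * toA f₂ :=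
  Subtype.ext (piAll_conv f₁ f₂)

lemma toA_invol (f : 𝒜) : toA (invol f) = star (toA f) := Subtype.ext (piAll_invol f)

lemma norm_toA (f : 𝒜) : ‖toA f‖ = ⨆ y, ‖rep f y‖ :=
  lp.norm_eq_ciSup (E := fun y : Y => Hy y →L[ℂ] Hy y) (piAll f)

lemma denseRange_toA : DenseRange toA := by
  intro a
  have h : (a : BigAlg) ∈ closure (Set.range piAll) := a.2
  rw [closure_subtype]
  convert! h using 2
  rw [← Set.range_comp]
  rfl

lemma toA_injective : Function.Injective toA := by
  classical
  intro f g h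
  ext z
  obtain ⟨x, rfl⟩ := Quotient.exists_rep z
  have h1 : rep f x.1.2 = rep g x.1.2 :=
    congrArg (fun a : A => (a : BigAlg).fiber x.1.2) h
  have h2 := rep_single f x.1.2 (cls x.1.2 x.1.1 x.2) (clsOne _)
  rw [h1, rep_single, pt_clsOne] at h2
  exact h2.symm

/-! ### The time evolution -/

/-- The function `Det(g)^{it}` on `Γ \ G_y`. -/
def phase (t : ℝ) (y : Y) : Coset y → ℂ :=
  Quotient.lift (fun g : Gy y => (g.1.det : ℂ) ^ (Complex.I * t)) (by
    rintro ⟨g, hg⟩ ⟨h, hh⟩ ⟨γ, e⟩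
    change h = ofSL γ * g at e
    subst e
    simp [det_mul, det_ofSL])

lemma phase_cls (t : ℝ) (y : Y) (g : GQ) (h : InM2 g y.1) :
    phase t y (cls y g h) = (g.det : ℂ) ^ (Complex.I * t) := rfl

lemma norm_det_cpow (g : GQ) (t : ℝ) : ‖(g.det : ℂ) ^ (Complex.I * t)‖ = 1 := by
  rw [Complex.norm_cpow_eq_rpow_re_of_pos (det_pos g)]
  simp

/-- The function `Det(g)^{it} f(g, y)` on `Z`. -/
def sigmaFun (t : ℝ) (f : Z → ℂ) : Z → ℂ :=
  Quotient.lift (fun x : D => (x.1.1.det : ℂ) ^ (Complex.I * t) * f (mk x.1.1 x.1.2 x.2)) (by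
    rintro x' x ⟨⟨a, b⟩, rfl⟩
    have e1 : ((a, b) • x : D).1.1.det = x.1.1.det := by
      rw [smul_D_fst, det_mul, det_mul, det_inv, det_ofSL, det_ofSL]
      simp
    have e2 : mk ((a, b) • x : D).1.1 ((a, b) • x : D).1.2 ((a, b) • x : D).2 =
      mk x.1.1 x.1.2 x.2 := mk_eq a b rfl rfl _ _
    change (((a, b) • x : D).1.1.det : ℂ) ^ _ * f (mk ((a, b) • x : D).1.1 _ _) = _
    rw [e1, e2])

lemma sigmaFun_mk (t : ℝ) (f : Z → ℂ) (g : GQ) (y : Y) (h : InM2 g y.1) :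
    sigmaFun t f (mk g y h) = (g.det : ℂ) ^ (Complex.I * t) * f (mk g y h) := rfl

/-- The time evolution `σ_t(f)(g, y) = Det(g)^{it} f(g, y)` on `𝒜`. -/
def sigma0 (t : ℝ) (f : 𝒜) : 𝒜 where
  toFun := sigmaFun t f
  continuous_toFun := by
    refine Continuous.quotient_lift ?_ _
    refine Continuous.mul ?_ (f.continuous.comp continuous_mk)
    exact (continuous_of_discreteTopology
      (f := fun g : GQ => (g.det : ℂ) ^ (Complex.I * t))).comp
      (continuous_fst.comp continuous_subtype_val)
  hasCompactSupport' := by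
    refine f.hasCompactSupport.mono fun z hz hz' => hz ?_
    obtain ⟨x, rfl⟩ := Quotient.exists_rep z
    change _ * f (Quotient.mk _ x) = 0
    rw [hz', mul_zero]

lemma exists_unitary (t : ℝ) (y : Y) :
    ∃ T : Hy y →L[ℂ] Hy y, ‖T‖ ≤ 1 ∧ ∀ ξ i, T ξ i = phase t y i * ξ i := by
  classical
  have h : IsFinKernel 1 1 fun i j : Coset y => if i = j then phase t y i else 0 := by
    refine ⟨fun i j => ?_, fun i => ⟨{i}, by simp, fun j => ?_⟩, fun j => ⟨{j}, by simp, fun i => ?_⟩⟩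
    · split_ifs
      · revert i
        refine coset_ind fun g hg _ => ?_
        rw [phase_cls, norm_det_cpow]
      · simp
    · simp +contextual [eq_comm]
    · simp +contextual
  obtain ⟨T, hT⟩ := exists_op ⟨1, 1, zero_le_one, h⟩
  refine ⟨T, by simpa using norm_op_le zero_le_one h hT, fun ξ i => ?_⟩
  rw [hT, tsum_eq_single i fun j hj => by rw [if_neg hj.symm, zero_mul], if_pos rfl]

/-- The unitary operator `e^{itH_y}` of `ℓ²(Γ \ G_y)`, multiplication by `Det(g)^{it}`. -/
def unitaryAt (t : ℝ) (y : Y) : Hy y →L[ℂ] Hy y := Classical.choose (exists_unitary t y)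

lemma unitaryAt_apply (t : ℝ) (y : Y) (ξ : Hy y) (i : Coset y) :
    unitaryAt t y ξ i = phase t y i * ξ i :=
  (Classical.choose_spec (exists_unitary t y)).2 ξ i

lemma phase_add (s t : ℝ) (y : Y) (i : Coset y) :
    phase (s + t) y i = phase s y i * phase t y i := by
  revert i
  refine coset_ind fun g hg => ?_
  rw [phase_cls, phase_cls, phase_cls, Complex.ofReal_add, mul_add, Complex.cpow_add]
  exact_mod_cast (det_pos g).ne'

lemma phase_zero (y : Y) (i : Coset y) : phase 0 y i = 1 := by
  revert i
  refine coset_ind fun g hg => ?_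
  rw [phase_cls]; simp

lemma star_phase (t : ℝ) (y : Y) (i : Coset y) : star (phase t y i) = phase (-t) y i := by
  have h1 : phase t y i * phase (-t) y i = 1 := by rw [← phase_add, add_neg_cancel, phase_zero]
  have h2 : ‖phase t y i‖ = 1 := by
    revert i
    exact coset_ind fun g hg _ => norm_det_cpow g t
  have h3 : phase t y i * star (phase t y i) = 1 := by
    rw [Complex.star_def, Complex.mul_conj, Complex.normSq_eq_norm_sq, h2]; simp
  have h4 : phase t y i ≠ 0 := fun h => by simp [h] at h1
  exact mul_left_cancel₀ h4 (h3.trans h1.symm)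

/-- The bounded family of the operators `e^{itH_y}`. -/
def bigU (t : ℝ) : BigAlg :=
  BigAlg.ofBounded (unitaryAt t) ⟨1, fun y => (Classical.choose_spec (exists_unitary t y)).1⟩

lemma bigU_mul (s t : ℝ) : bigU s * bigU t = bigU (s + t) := by
  refine BigAlg.ext fun y => ?_
  change unitaryAt s y * unitaryAt t y = unitaryAt (s + t) y
  ext ξ i
  change unitaryAt s y (unitaryAt t y ξ) i = _
  rw [unitaryAt_apply, unitaryAt_apply, unitaryAt_apply, phase_add, mul_assoc]

lemma bigU_zero_mul (b : BigAlg) : bigU 0 * b = b := by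
  refine BigAlg.ext fun y => ?_
  change unitaryAt 0 y * b.fiber y = b.fiber y
  ext ξ i
  change unitaryAt 0 y (b.fiber y ξ) i = _
  rw [unitaryAt_apply, phase_zero, one_mul]

lemma star_bigU (t : ℝ) : star (bigU t) = bigU (-t) := by
  classical
  refine BigAlg.ext fun y => ?_
  change star (unitaryAt t y) = unitaryAt (-t) y
  refine op_ext fun i j => ?_
  have hT : ∀ ξ i, unitaryAt t y ξ i = ∑' j, (if i = j then phase t y i else 0) * ξ j :=
    fun ξ i => by
      rw [unitaryAt_apply, tsum_eq_single i fun j hj => by rw [if_neg hj.symm, zero_mul], if_pos rfl]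
  rw [star_op_single hT, unitaryAt_apply]
  by_cases h : i = j
  · subst h
    rw [if_pos rfl, star_phase, lp.single_apply_self, mul_one]
  · rw [if_neg fun h' => h h'.symm, lp.single_apply_ne (E := fun _ : Coset y => ℂ) 2 j (1 : ℂ) h]
    simp

lemma mul_bigU_zero (b : BigAlg) : b * bigU 0 = b := by
  have := congrArg star (bigU_zero_mul (star b))
  rwa [star_mul, star_star, star_bigU, neg_zero] at this

lemma conj_piAll (t : ℝ) (f : 𝒜) : bigU t * piAll f * bigU (-t) = piAll (sigma0 t f) := by
  classical
  refine BigAlg.ext fun y => ?_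
  refine rep_eq fun i j => ?_
  change unitaryAt t y (rep f y (unitaryAt (-t) y _)) i = sigmaFun t f (pt y i j)
  have e : unitaryAt (-t) y (lp.single 2 j (1 : ℂ)) =
      phase (-t) y j • (lp.single 2 j (1 : ℂ) : Hy y) := by
    ext l
    rw [unitaryAt_apply]
    change _ = phase (-t) y j * _
    by_cases h : l = j
    · rw [h]
    · rw [lp.single_apply_ne (E := fun _ : Coset y => ℂ) 2 j (1 : ℂ) h, mul_zero, mul_zero]
  rw [e, map_smul, unitaryAt_apply]
  change phase t y i * (phase (-t) y j * rep f y _ i) = _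
  rw [rep_single]
  revert i j
  refine coset_ind fun g hg => coset_ind fun h hh _ => ?_
  rw [pt_cls, sigmaFun_mk, phase_cls, phase_cls, ← mul_assoc]
  congr 1
  rw [det_mul, det_inv, Complex.ofReal_mul, Complex.mul_cpow_ofReal_nonneg (det_pos g).le
    (inv_pos.2 (det_pos h)).le, Complex.ofReal_neg, mul_neg, Complex.cpow_neg, Complex.ofReal_inv,
    Complex.inv_cpow]
  rw [Complex.arg_ofReal_of_nonneg (det_pos h).le]
  exact Real.pi_pos.ne

lemma conj_mem (t : ℝ) {b : BigAlg} (hb : b ∈ ASub) : bigU t * b * bigU (-t) ∈ ASub := by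
  refine map_mem_closure (s := (A0 : Set BigAlg)) (t := (A0 : Set BigAlg))
    (f := fun b : BigAlg => bigU t * b * bigU (-t)) ?_ hb ?_
  · exact (continuous_const.mul continuous_id).mul continuous_const
  · rintro _ ⟨f, rfl⟩
    exact ⟨sigma0 t f, (conj_piAll t f).symm⟩

lemma conj_conj (s t : ℝ) (b : BigAlg) :
    bigU s * (bigU t * b * bigU (-t)) * bigU (-s) = bigU (s + t) * b * bigU (-(s + t)) := by
  have e : -(s + t) = -t + -s := by ring
  rw [e, ← bigU_mul s t, ← bigU_mul (-t) (-s)]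
  simp only [mul_assoc]

/-- The one parameter group `σ_t` of automorphisms of `A`: it is given on each `ℓ²(Γ \ G_y)` by
`e^{itH_y} · e^{-itH_y}`, and on `𝒜` by `σ_t(f)(g, y) = Det(g)^{it} f(g, y)`. -/
def sigma (t : ℝ) : A ≃⋆ₐ[ℂ] A where
  toFun a := ⟨bigU t * a.1 * bigU (-t), conj_mem t a.2⟩
  invFun a := ⟨bigU (-t) * a.1 * bigU (- -t), conj_mem (-t) a.2⟩
  left_inv a := Subtype.ext (by
    change bigU (-t) * (bigU t * a.1 * bigU (-t)) * bigU (- -t) = a.1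
    rw [conj_conj, neg_add_cancel, neg_zero, bigU_zero_mul, mul_bigU_zero])
  right_inv a := Subtype.ext (by
    change bigU t * (bigU (-t) * a.1 * bigU (- -t)) * bigU (-t) = a.1
    rw [conj_conj, add_neg_cancel, neg_zero, bigU_zero_mul, mul_bigU_zero])
  map_mul' a b := Subtype.ext (by
    change bigU t * (a.1 * b.1) * bigU (-t) =
      bigU t * a.1 * bigU (-t) * (bigU t * b.1 * bigU (-t))
    have : bigU (-t) * (bigU t * b.1 * bigU (-t)) = b.1 * bigU (-t) := by
      rw [← mul_assoc, ← mul_assoc, bigU_mul, neg_add_cancel, bigU_zero_mul]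
    simp only [mul_assoc] at this ⊢
    rw [this])
  map_add' a b := Subtype.ext (by
    change bigU t * (a.1 + b.1) * bigU (-t) = _
    rw [mul_add, add_mul]; rfl)
  map_star' a := Subtype.ext (by
    change bigU t * star a.1 * bigU (-t) = star (bigU t * a.1 * bigU (-t))
    rw [star_mul, star_mul, star_bigU, star_bigU, neg_neg, mul_assoc])
  map_smul' c a := Subtype.ext (by
    change bigU t * (c • a.1) * bigU (-t) = c • (bigU t * a.1 * bigU (-t))
    rw [mul_smul_comm, smul_mul_assoc])

lemma sigma_toA (t : ℝ) (f : 𝒜) : sigma t (toA f) = toA (sigma0 t f) :=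
  Subtype.ext (conj_piAll t f)

lemma sigma_add (s t : ℝ) (a : A) : sigma (s + t) a = sigma s (sigma t a) :=
  Subtype.ext (conj_conj s t a.1).symm

/-! ### The measure on `X`, states and the KMS condition -/

instance : MeasurableSpace M2R := borel M2R

instance : BorelSpace M2R := ⟨rfl⟩

/-- The normalized Haar measure of the additive compact group `M₂(R)`. -/
def haarM2 : Measure M2R := Measure.addHaarMeasure ⊤

/-- The measure of the Poincaré metric on the upper half plane, normalized so that `Γ \ ℍ`, or
equivalently the standard fundamental domain of `Γ`, has measure `1`. -/
def muH : Measure ℍ := (volume ModularGroup.fd)⁻¹ • (volume : Measure ℍ)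

/-- The measure `dy = dρ × dμ(τ)` on `X = Γ \ Y`. A subset of `X` is measurable if its preimage in
`Y` is, and its measure is that of the part of its preimage which lies over the standard
fundamental domain of the action of `Γ` on `ℍ`. -/
def muX : Measure X :=
  ((haarM2.prod muH).restrict (Set.univ ×ˢ ModularGroup.fd)).map (Quotient.mk _)

/-- The function `y ↦ f(1, y)` on `X`, for `f` in `𝒜`. -/
def unitVal (f : 𝒜) : X → ℂ :=
  Quotient.lift (fun y : Y => f (mk 1 y (inM2_one y.1))) (by
    rintro y' y ⟨γ, rfl⟩
    exact congrArg f (mk_eq γ γ (by simp) rfl _ _))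

open scoped ComplexOrder in
/-- States of a (not necessarily unital) `C*`-algebra: positive linear forms of norm one. -/
def IsState {B : Type*} [NonUnitalCStarAlgebra B] (φ : B →L[ℂ] ℂ) : Prop :=
  ‖φ‖ = 1 ∧ ∀ a : B, 0 ≤ φ (star a * a)

/-- The KMS condition at inverse temperature `β`: for all `a, b` there is a bounded continuous
function `F` on the strip `0 ≤ Im z ≤ β`, holomorphic in its interior, with
`F(t) = φ(a σ_t(b))` and `F(t + iβ) = φ(σ_t(b) a)` for all real `t`. -/
def IsKMS {B : Type*} [NonUnitalCStarAlgebra B] (σ : ℝ → B ≃⋆ₐ[ℂ] B) (β : ℝ) (φ : B →L[ℂ] ℂ) :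
    Prop :=
  ∀ a b : B, ∃ F : ℂ → ℂ,
    ContinuousOn F {z | 0 ≤ z.im ∧ z.im ≤ β} ∧
    DifferentiableOn ℂ F {z | 0 < z.im ∧ z.im < β} ∧
    (∃ C : ℝ, ∀ z : ℂ, 0 ≤ z.im → z.im ≤ β → ‖F z‖ ≤ C) ∧
    ∀ t : ℝ, F t = φ (a * σ t b) ∧ F (t + Complex.I * β) = φ (σ t b * a)

end

end GL2System

namespace GL2System

noncomputable section

open Matrix UpperHalfPlane Topology
open scoped MatrixGroups ENNReal CompactlySupported

/-! ### Scaling of the Haar measure of `M₂(R)` -/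

/-! Everything rests on one computation. At `g = 1` the convolution is `(f₁ * f₂)(1, y) = ∑ f₁(h⁻¹,
h y) f₂(h, y)`, summed over `h` in `Γ \ G_y`. With `flip f (g, y) = f(g⁻¹, g y)`, and with `sumInt
k` for the integral over `X` of the coset sums of a function `k` on `Z`, this says that `φ(f₁ * f₂)
= sumInt (flip f₁ · f₂)` for the pointwise product (`phi0_conv`). Positivity follows at once: for
`f* * f` the integrand is a sum of terms `|f(h, y)|²`.

The KMS condition comes from the behaviour of `sumInt` under the inversion of `Z`: `sumInt (flip k)
= sumInt (det⁻² k)` (`sumInt_flip`). To see this, choose the representative of `h` that moves `y`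
into the fundamental domain. For almost all `y` there are exactly two, differing by a sign, so `2
sumInt k` is the sum over all `g` in `GL₂⁺(ℚ)` of the integral of `k(g, y)` over the `y` for which
both `y` and `g y` lie over the fundamental domain (`two_mul_sumInt`). This description is symmetric
under `(g, y) ↦ (g⁻¹, g y)` except for the Jacobian of `y ↦ g y`. The Poincaré measure is invariant.
On `M₂(R)`, left multiplication acts separately on the two columns, each contributing a factor `det
g`, whence the square (`map_gmulExt`) and the inverse temperature 2.

For `f, g` in `𝒜` put `F(z) = sumInt (det^{iz} · flip f · g)`. Only finitely many classes of `Γ \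
GL₂⁺(ℚ)` occur, so `F` is a finite sum of exponentials, hence entire, and bounded on the strip. On
the real line it is `φ(f σ_t(g))`; at `t + 2i` the factor `det⁻²` appears and `sumInt_flip`
exchanges the two arguments (`isKMSFun_toA`). General elements of `A` are reached by density: by the
three lines theorem the functions `F` of approximating sequences converge uniformly on the strip
(`exists_isKMSFun_of_tendsto`).

Continuity with norm at most one holds because `f(1, y)` is a diagonal matrix coefficient of
`π_y(f)` (`norm_kext_one_le`). The norm is attained in the limit on functions supported on the
classes of pairs `(γ, y)` with `γ` in `Γ`, for which `π_y` is diagonal (`muH_truncated_le`). -/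

instance : Measure.IsAddHaarMeasure haarM2 := by unfold haarM2; infer_instance

instance : IsProbabilityMeasure haarM2 := ⟨Measure.addHaarMeasure_self⟩

/-- An integral matrix, seen in `M₂(R)`. -/
def intMat : Matrix (Fin 2) (Fin 2) ℤ →+* M2R := (Int.castRingHom Zhat).mapMatrix

lemma intMat_apply (m : Matrix (Fin 2) (Fin 2) ℤ) (i j : Fin 2) : intMat m i j = (m i j : Zhat) :=
  rfl

/-- Left multiplication by an integral matrix on `M₂(R)`. -/
def intMul (m : Matrix (Fin 2) (Fin 2) ℤ) : M2R →+ M2R := AddMonoidHom.mulLeft (intMat m)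

lemma intMul_apply (m : Matrix (Fin 2) (Fin 2) ℤ) (ρ : M2R) : intMul m ρ = intMat m * ρ := rfl

lemma intMul_mul (m n : Matrix (Fin 2) (Fin 2) ℤ) (ρ : M2R) :
    intMul (m * n) ρ = intMul m (intMul n ρ) := by
  simp only [intMul_apply, map_mul, mul_assoc]

lemma continuous_intMul (m : Matrix (Fin 2) (Fin 2) ℤ) : Continuous (intMul m) :=
  continuous_const.matrix_mul continuous_id

lemma intCast_mul_injective {d : ℤ} (hd : d ≠ 0) {x y : Zhat} (h : (d : Zhat) * x = d * y) :
    x = y := by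
  funext p
  have h1 : (d : ℤ_[(p : ℕ)]) * x p = d * y p := by
    have := congrFun h p
    simpa using this
  exact mul_left_cancel₀ (Int.cast_ne_zero.2 hd) h1

/-- Multiplying by the adjugate reduces to the scalar `det m`, and a non-zero integer is not a zero
divisor in any `ℤ_p`. -/
lemma intMul_injective {m : Matrix (Fin 2) (Fin 2) ℤ} (hm : m.det ≠ 0) :
    Function.Injective (intMul m) := by
  intro ρ σ h
  have h1 : intMul (m.adjugate * m) ρ = intMul (m.adjugate * m) σ := by
    rw [intMul_mul, intMul_mul, h]
  rw [Matrix.adjugate_mul] at h1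
  have h2 : ∀ (ρ : M2R) i j, intMul (m.det • (1 : Matrix (Fin 2) (Fin 2) ℤ)) ρ i j =
      (m.det : Zhat) * ρ i j := by
    intro ρ i j
    rw [intMul_apply, map_zsmul, map_one, smul_mul_assoc, one_mul, Matrix.smul_apply, zsmul_eq_mul]
  ext1 i j
  refine intCast_mul_injective hm ?_
  rw [← h2, ← h2, h1]

lemma isClosedEmbedding_intMul {m : Matrix (Fin 2) (Fin 2) ℤ} (hm : m.det ≠ 0) :
    IsClosedEmbedding (intMul m) :=
  (continuous_intMul m).isClosedEmbedding (intMul_injective hm)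

/-- Left multiplication by `m` divides the Haar measure of `M₂(R)` by `det(m)²`. -/
def ScalesHaar (m : Matrix (Fin 2) (Fin 2) ℤ) : Prop :=
  ∀ S : Set M2R, haarM2 S = (m.det.natAbs : ℝ≥0∞) ^ 2 * haarM2 (intMul m '' S)

lemma ScalesHaar.mul {m n : Matrix (Fin 2) (Fin 2) ℤ} (hm : ScalesHaar m) (hn : ScalesHaar n) :
    ScalesHaar (m * n) := by
  intro S
  have e : intMul (m * n) '' S = intMul m '' (intMul n '' S) := by
    rw [Set.image_image]
    exact Set.image_congr fun ρ _ => intMul_mul m n ρ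
  rw [e, hn S, hm (intMul n '' S), Matrix.det_mul, Int.natAbs_mul]
  push_cast
  ring

/-- The pullback of Haar measure by an injective continuous endomorphism is again translation
invariant, so by uniqueness it is a multiple of Haar measure, and the total mass determines the
multiple. As the map is a measurable embedding, no measurability of the set is needed, which lets
the property compose freely in `ScalesHaar.mul`. -/
lemma scalesHaar_of_univ {m : Matrix (Fin 2) (Fin 2) ℤ} (hm : m.det ≠ 0)
    (h : (m.det.natAbs : ℝ≥0∞) ^ 2 * haarM2 (Set.range (intMul m)) = 1) : ScalesHaar m := by
  have he : MeasurableEmbedding (intMul m) := (isClosedEmbedding_intMul hm).measurableEmbedding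
  have hinv : (Measure.comap (intMul m) haarM2).IsAddLeftInvariant :=
    Measure.IsAddLeftInvariant.comap _ he
  have hfin : IsFiniteMeasure (Measure.comap (intMul m) haarM2) :=
    ⟨by rw [he.comap_apply]; exact measure_lt_top _ _⟩
  have key := Measure.isAddInvariant_eq_smul_of_compactSpace (Measure.comap (intMul m) haarM2) haarM2
  intro S
  have h1 : ∀ S, haarM2 (intMul m '' S) =
      ((Measure.comap (intMul m) haarM2).addHaarScalarFactor haarM2 : ℝ≥0∞) * haarM2 S := by
    intro S
    rw [← he.comap_apply haarM2 S]
    conv_lhs => rw [key]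
    rw [Measure.smul_apply, ENNReal.smul_def, smul_eq_mul]
  have h2 := h1 Set.univ
  rw [Set.image_univ, measure_univ, mul_one] at h2
  rw [h1, ← h2, ← mul_assoc, h, one_mul]

lemma scalesHaar_of_isUnit {m n : Matrix (Fin 2) (Fin 2) ℤ} (h : m * n = 1) : ScalesHaar m := by
  have hu : m.det * n.det = 1 := by rw [← Matrix.det_mul, h, Matrix.det_one]
  have hd : m.det.natAbs = 1 := Int.isUnit_iff_natAbs_eq.1 (IsUnit.of_mul_eq_one _ hu)
  refine scalesHaar_of_univ (left_ne_zero_of_mul_eq_one hu) ?_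
  have : Set.range (intMul m) = Set.univ :=
    Set.range_eq_univ.2 fun ρ => ⟨intMul n ρ, by rw [← intMul_mul, h, intMul_apply]; simp⟩
  rw [this, hd, measure_univ, Nat.cast_one, one_pow, one_mul]

/-- Only the component at `p` matters, because `p` is a unit in `ℤ_q` for every other prime `q`. -/
lemma natCast_dvd_zhat (p : P) (x : Zhat) (h : ((p : ℕ) : ℤ_[(p : ℕ)]) ∣ x p) :
    ∃ y : Zhat, x = ((p : ℕ) : ℤ) * y := by
  have key : ∀ q : P, ∃ y : ℤ_[(q : ℕ)], x q = ((p : ℕ) : ℤ_[(q : ℕ)]) * y := by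
    intro q
    by_cases hq : q = p
    · subst hq; exact h
    · have hu : IsUnit ((p : ℕ) : ℤ_[(q : ℕ)]) := by
        rw [PadicInt.isUnit_iff, PadicInt.norm_natCast_eq_one_iff]
        exact (Nat.coprime_primes q.2 p.2).2 fun e => hq (Subtype.ext e)
      exact hu.dvd
  choose y hy using key
  refine ⟨y, funext fun q => (hy q).trans ?_⟩
  rw [Pi.mul_apply]
  norm_cast

/-- The first row of a matrix of `M₂(R)`, modulo `p`. -/
def rowMod (p : P) : M2R →+ (Fin 2 → ZMod (p : ℕ)) where
  toFun ρ j := PadicInt.toZMod (ρ 0 j p)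
  map_zero' := by ext j; simp
  map_add' ρ σ := by ext j; simp

lemma rowMod_surjective (p : P) : Function.Surjective (rowMod p) := by
  intro v
  refine ⟨fun _ j => ((v j).val : Zhat), ?_⟩
  funext j
  change PadicInt.toZMod (((v j).val : Zhat) p) = v j
  simp

/-- The image is the subgroup of matrices whose first row vanishes modulo `p`. The row has two
entries, so the index is `p²`, which is the square of the determinant. -/
lemma scalesHaar_prime (p : P) : ScalesHaar !![((p : ℕ) : ℤ), 0; 0, 1] := by
  have hdet : (!![((p : ℕ) : ℤ), 0; 0, 1] : Matrix (Fin 2) (Fin 2) ℤ).det = (p : ℕ) := by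
    simp [Matrix.det_fin_two]
  have h0 : (!![((p : ℕ) : ℤ), 0; 0, 1] : Matrix (Fin 2) (Fin 2) ℤ).det ≠ 0 := by
    rw [hdet]; exact_mod_cast p.2.ne_zero
  refine scalesHaar_of_univ h0 ?_
  have hr : Set.range (intMul !![((p : ℕ) : ℤ), 0; 0, 1]) = ((rowMod p).ker : Set M2R) := by
    ext ρ
    rw [SetLike.mem_coe, AddMonoidHom.mem_ker]
    constructor
    · rintro ⟨σ, rfl⟩
      funext j
      change PadicInt.toZMod ((intMul _ σ) 0 j p) = 0
      have : (intMul !![((p : ℕ) : ℤ), 0; 0, 1] σ) 0 j = ((p : ℕ) : Zhat) * σ 0 j := by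
        rw [intMul_apply, Matrix.mul_apply, Fin.sum_univ_two, intMat_apply, intMat_apply]
        simp
      rw [this]
      simp
    · intro h
      have h1 : ∀ j, ∃ y : Zhat, ρ 0 j = ((p : ℕ) : ℤ) * y := by
        intro j
        refine natCast_dvd_zhat p _ ?_
        have h2 : PadicInt.toZMod (ρ 0 j p) = 0 := congrFun h j
        rw [← RingHom.mem_ker, PadicInt.ker_toZMod, PadicInt.maximalIdeal_eq_span_p,
          Ideal.mem_span_singleton] at h2
        exact h2
      choose y hy using h1
      refine ⟨Matrix.of ![y, ρ 1], ?_⟩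
      ext1 i j
      rw [intMul_apply, Matrix.mul_apply, Fin.sum_univ_two, intMat_apply, intMat_apply]
      fin_cases i
      · simpa using (hy j).symm
      · simp
  have hm : MeasurableSet ((rowMod p).ker : Set M2R) := by
    rw [← hr]
    exact (isClosedEmbedding_intMul h0).isClosed_range.measurableSet
  have hi : (rowMod p).ker.index = (p : ℕ) ^ 2 := by
    rw [AddSubgroup.index_ker, (AddMonoidHom.range_eq_top).2 (rowMod_surjective p)]
    simp
  have : (rowMod p).ker.FiniteIndex := ⟨by rw [hi]; exact pow_ne_zero _ p.2.ne_zero⟩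
  have := AddSubgroup.index_mul_measure (rowMod p).ker hm haarM2
  rw [hi, measure_univ] at this
  rw [hdet, hr, ← this]
  simp

lemma scalesHaar_diag (n : ℕ) (hn : n ≠ 0) : ScalesHaar !![(n : ℤ), 0; 0, 1] := by
  induction n using induction_on_primes with
  | zero => exact absurd rfl hn
  | one =>
    refine scalesHaar_of_isUnit (n := 1) ?_
    ext i j; fin_cases i <;> fin_cases j <;> simp
  | prime_mul p a hp ih =>
    have h := (scalesHaar_prime ⟨p, hp⟩).mul (ih (right_ne_zero_of_mul hn))
    convert h using 1
    ext i j; fin_cases i <;> fin_cases j <;> simp [Matrix.mul_apply]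

lemma scalesHaar_SL (γ : SL(2, ℤ)) : ScalesHaar γ.1 :=
  scalesHaar_of_isUnit (n := (γ⁻¹).1) (by
    rw [← Matrix.SpecialLinearGroup.coe_mul, mul_inv_cancel, Matrix.SpecialLinearGroup.coe_one])

/-- With `S` the permutation matrix and `U` the unipotent one, the matrix factors as `S · diag(d, 1)
· S · U · diag(a, 1)`. -/
lemma scalesHaar_upper {a b d : ℤ} (ha : 0 < a) (hd : 0 < d) : ScalesHaar !![a, b; 0, d] := by
  lift a to ℕ using ha.le
  lift d to ℕ using hd.le
  have hS : ScalesHaar !![0, 1; 1, 0] := scalesHaar_of_isUnit (n := !![0, 1; 1, 0]) (by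
    ext i j; fin_cases i <;> fin_cases j <;> simp)
  have hU : ScalesHaar !![1, b; 0, 1] := scalesHaar_of_isUnit (n := !![1, -b; 0, 1]) (by
    ext i j; fin_cases i <;> fin_cases j <;> simp [Matrix.mul_apply])
  have h := (((hS.mul (scalesHaar_diag d (by lia))).mul hS).mul hU).mul (scalesHaar_diag a (by lia))
  convert h using 1
  ext i j; fin_cases i <;> fin_cases j <;> simp [Matrix.mul_apply]

/-- Row reduction by the generators `S` and `T` of `SL₂(ℤ)`, which preserve Haar measure, brings the
matrix to upper triangular form with positive diagonal. -/
lemma scalesHaar {m : Matrix (Fin 2) (Fin 2) ℤ} (hm : 0 < m.det) : ScalesHaar m := by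
  have key : ∀ A : FixedDetMatrix (Fin 2) ℤ m.det, ScalesHaar A.1 := by
    intro A
    induction A using FixedDetMatrices.induction_on hm.ne' with
    | h0 A h1 h2 h3 h4 =>
      have e : A.1 = !![A.1 0 0, A.1 0 1; 0, A.1 1 1] := by
        rw [← h1]; exact Matrix.eta_fin_two _
      have hd : 0 < A.1 1 1 := by
        have := A.2
        rw [Matrix.det_fin_two, h1, mul_zero, sub_zero] at this
        rw [← this] at hm
        exact pos_of_mul_pos_right hm h2.le
      rw [e]
      exact scalesHaar_upper h2 hd
    | hS B h => exact (scalesHaar_SL _).mul h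
    | hT B h => exact (scalesHaar_SL _).mul h
  exact key ⟨m, rfl⟩

/-! ### The partial action of a rational matrix on `M₂(R)` -/

/-- The set of the `ρ` in `M₂(R)` with `g ρ` in `M₂(R)`. -/
def domM (g : GQ) : Set M2R := {ρ | InM2 g ρ}

lemma mem_domM {g : GQ} {ρ : M2R} : ρ ∈ domM g ↔ InM2 g ρ := Iff.rfl

lemma measurableSet_domM (g : GQ) : MeasurableSet (domM g) := (isClopen_inM2 g).isOpen.measurableSet

open Classical in
/-- The product `g ρ`, extended by `ρ` where it is not defined. -/
def gmulExt (g : GQ) (ρ : M2R) : M2R := if h : InM2 g ρ then gmul g ρ h else ρ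

lemma gmulExt_of {g : GQ} {ρ : M2R} (h : InM2 g ρ) : gmulExt g ρ = gmul g ρ h := dif_pos h

lemma measurable_gmulExt (g : GQ) : Measurable (gmulExt g) := by
  classical
  exact Measurable.dite (s := {ρ | InM2 g ρ}) (continuous_gmul g).measurable
    measurable_subtype_coe (measurableSet_domM g)

lemma gmulExt_mem {g : GQ} {ρ : M2R} (h : ρ ∈ domM g) : gmulExt g ρ ∈ domM g⁻¹ := by
  rw [gmulExt_of (mem_domM.1 h)]
  exact inM2_inv (mem_domM.1 h)

lemma gmulExt_inv {g : GQ} {ρ : M2R} (h : ρ ∈ domM g) : gmulExt g⁻¹ (gmulExt g ρ) = ρ := by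
  rw [gmulExt_of (mem_domM.1 (gmulExt_mem h))]
  refine (eq_gmul ?_).symm
  rw [gmulExt_of (mem_domM.1 h), emb_gmul, ← mul_assoc, ← map_mul, inv_mul_cancel, map_one, one_mul]

lemma exists_integral_multiple (g : GQ) : ∃ (b : ℤ) (m : Matrix (Fin 2) (Fin 2) ℤ), b ≠ 0 ∧
    ∀ i j, (m i j : ℚ) = b * (g.toGL : Matrix (Fin 2) (Fin 2) ℚ) i j := by
  obtain ⟨⟨b, hb⟩, hM⟩ := IsLocalization.exist_integer_multiples_of_finite (nonZeroDivisors ℤ)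
    (fun q : Fin 2 × Fin 2 => (g.toGL : Matrix (Fin 2) (Fin 2) ℚ) q.1 q.2)
  choose M hM using hM
  refine ⟨b, fun i j => M (i, j), nonZeroDivisors.ne_zero hb, fun i j => ?_⟩
  have := hM (i, j)
  simpa using this

lemma intMul_gmul {g : GQ} {b : ℤ} {m : Matrix (Fin 2) (Fin 2) ℤ}
    (hm : ∀ i j, (m i j : ℚ) = b * (g.toGL : Matrix (Fin 2) (Fin 2) ℚ) i j) {ρ : M2R}
    (h : InM2 g ρ) : intMul (b • 1) (gmul g ρ h) = intMul m ρ := by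
  refine emb_injective ?_
  have e1 : emb (intMat m) = (b : ℤ) • g.mat := by
    ext i j p
    rw [emb_apply, intMat_apply, Matrix.smul_apply, Pi.smul_apply, GQ.mat_apply, zsmul_eq_mul]
    have := congrArg (Rat.cast : ℚ → ℚ_[(p : ℕ)]) (hm i j)
    push_cast at this
    rw [← this]
    change (((m i j : ℤ_[(p : ℕ)])) : ℚ_[(p : ℕ)]) = _
    simp
  rw [intMul_apply, intMul_apply, map_mul, map_mul, emb_gmul, e1, map_zsmul, map_one, map_zsmul,
    map_one, smul_mul_assoc, one_mul, smul_mul_assoc]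

/-- Clear denominators: if `m = b g` is integral, then `b (g T) = m T`. The integral case applied to
`m` on `T` and to the scalar matrix `b` on `g T` gives the factors `(b² det g)²` and `(b²)²`, whose
quotient is `(det g)²`. -/
lemma haar_image_gmulExt (g : GQ) {T : Set M2R} (hT : T ⊆ domM g) :
    haarM2 T = ENNReal.ofReal g.det ^ 2 * haarM2 (gmulExt g '' T) := by
  obtain ⟨b, m, hb, hm⟩ := exists_integral_multiple g
  have hdet : (m.det : ℝ) = b ^ 2 * g.det := by
    have : (m.det : ℚ) = b ^ 2 * (g.toGL : Matrix (Fin 2) (Fin 2) ℚ).det := by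
      rw [Matrix.det_fin_two, Matrix.det_fin_two]
      push_cast
      rw [hm, hm, hm, hm]
      ring
    have h2 := congrArg (Rat.cast : ℚ → ℝ) this
    rw [Rat.cast_mul, Rat.cast_pow, Rat.cast_intCast, Rat.cast_intCast] at h2
    exact h2
  have hb2 : (0 : ℝ) < (b : ℝ) ^ 2 := by positivity
  have hpos : 0 < m.det := by
    have : (0 : ℝ) < m.det := by rw [hdet]; exact mul_pos hb2 (det_pos g)
    exact_mod_cast this
  have hbdet : (b • (1 : Matrix (Fin 2) (Fin 2) ℤ)).det = b ^ 2 := by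
    rw [Matrix.det_smul, Matrix.det_one, mul_one, Fintype.card_fin]
  have him : intMul (b • 1) '' (gmulExt g '' T) = intMul m '' T := by
    rw [Set.image_image]
    refine Set.image_congr fun ρ hρ => ?_
    rw [gmulExt_of (mem_domM.1 (hT hρ)), intMul_gmul hm]
  have h1 := scalesHaar (m := b • 1) (by rw [hbdet]; positivity) (gmulExt g '' T)
  have h2 := scalesHaar hpos T
  rw [him, hbdet] at h1
  rw [h2, h1, ← mul_assoc]
  congr 1
  rw [← mul_pow]
  congr 1
  have e1 : ((m.det.natAbs : ℕ) : ℝ≥0∞) = ENNReal.ofReal m.det := by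
    rw [← ENNReal.ofReal_natCast, Nat.cast_natAbs, abs_of_pos hpos]
  have e2 : (((b ^ 2).natAbs : ℕ) : ℝ≥0∞) = ENNReal.ofReal ((b : ℝ) ^ 2) := by
    rw [← ENNReal.ofReal_natCast, Nat.cast_natAbs, abs_of_nonneg (sq_nonneg b)]
    push_cast; rfl
  rw [e1, e2, hdet, ← ENNReal.ofReal_mul (det_pos g).le, mul_comm]

/-- The partial action is a bijection from `domM g` onto `domM g⁻¹`, so the scaling of sets becomes
a change of variables formula. Restricting to `domM g` makes the value chosen outside the domain
irrelevant. -/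
lemma map_gmulExt (g : GQ) : (haarM2.restrict (domM g)).map (gmulExt g) =
    ENNReal.ofReal g.det ^ 2 • haarM2.restrict (domM g⁻¹) := by
  ext B hB
  rw [Measure.map_apply (measurable_gmulExt g) hB,
    Measure.restrict_apply (measurable_gmulExt g hB), Measure.smul_apply,
    Measure.restrict_apply hB, smul_eq_mul, haar_image_gmulExt g Set.inter_subset_right]
  congr 2
  ext σ
  constructor
  · rintro ⟨ρ, ⟨h1, h2⟩, rfl⟩
    exact ⟨h1, gmulExt_mem h2⟩
  · rintro ⟨h1, h2⟩
    have h3 := gmulExt_mem h2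
    have h4 := gmulExt_inv h2
    rw [inv_inv] at h3 h4
    exact ⟨gmulExt g⁻¹ σ, ⟨by rw [Set.mem_preimage, h4]; exact h1, h3⟩, h4⟩

/-! ### The action on `Y` and the measure `dρ × dμ` -/

/-- The interior of the fundamental domain is open and non-empty (it contains `2i`), and the
hyperbolic density is positive there. -/
lemma volume_fd_ne_zero : (volume ModularGroup.fd : ℝ≥0∞) ≠ 0 := by
  intro h
  have h1 : (volume ModularGroup.fdo : ℝ≥0∞) = 0 :=
    measure_mono_null ModularGroup.fdo_subset_fd h
  have hemb : UpperHalfPlane.coe '' ModularGroup.fdo =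
    {z : ℂ | 0 < z.im ∧ 1 < ‖z‖ ∧ |z.re| < 1/2} := ModularGroup.coe_fdo
  rw [volume_eq_lintegral, hemb] at h1
  have ho : IsOpen {z : ℂ | 0 < z.im ∧ 1 < ‖z‖ ∧ |z.re| < 1/2} := by
    refine .inter (isOpen_lt continuous_const Complex.continuous_im) (.inter ?_ ?_)
    · exact isOpen_lt continuous_const continuous_norm
    · exact isOpen_lt (continuous_abs.comp Complex.continuous_re) continuous_const
  have hne : {z : ℂ | 0 < z.im ∧ 1 < ‖z‖ ∧ |z.re| < 1/2}.Nonempty :=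
    ⟨2 * Complex.I, by simp, by simp, by simp⟩
  have hm : Measurable fun z : ℂ => (((1 / ‖z.im‖₊) ^ 2 : NNReal) : ℝ≥0∞) := by fun_prop
  rw [lintegral_eq_zero_iff hm] at h1
  have h2 := (ae_restrict_iff' ho.measurableSet).1 h1
  have h3 : (volume {z : ℂ | 0 < z.im ∧ 1 < ‖z‖ ∧ |z.re| < 1/2} : ℝ≥0∞) = 0 := by
    refine measure_mono_null (fun z hz => ?_) h2
    intro h4
    have h5 := h4 hz
    have h6 : ‖z.im‖₊ ≠ 0 := by simpa using hz.1.ne'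
    simp [h6] at h5
  exact (ho.measure_pos _ hne).ne' h3

/-- The fundamental domain satisfies `Im τ ≥ √3/2`, so it lies in the half-strip `|x| ≤ 1/2`, `y >
1/2`, over which `dx dy / y²` has finite integral. -/
lemma volume_fd_ne_top : (volume ModularGroup.fd : ℝ≥0∞) ≠ ∞ := by
  have hsub : UpperHalfPlane.coe '' ModularGroup.fd ⊆
      Complex.measurableEquivRealProd ⁻¹' (Set.Icc (-(1 / 2)) (1 / 2) ×ˢ Set.Ioi (1 / 2)) := by
    rintro _ ⟨τ, hτ, rfl⟩
    have h1 := ModularGroup.three_le_four_mul_im_sq_of_mem_fd hτ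
    have h2 := τ.im_pos
    refine ⟨abs_le.1 hτ.2, ?_⟩
    change 1 / 2 < τ.im
    nlinarith
  have hC : ∫⁻ y in Set.Ioi (1 / 2 : ℝ), (((1 / ‖y‖₊) ^ 2 : NNReal) : ℝ≥0∞) ≠ ∞ := by
    have h := (integrableOn_Ioi_rpow_of_lt (a := -2) (by norm_num)
      (by norm_num : (0 : ℝ) < 1 / 2)).lintegral_lt_top
    refine ne_of_lt (lt_of_le_of_lt (setLIntegral_mono' measurableSet_Ioi fun y hy => ?_) h)
    have hy0 : (0 : ℝ) < y := lt_trans (by norm_num) hy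
    rw [ENNReal.le_ofReal_iff_toReal_le ENNReal.coe_ne_top (by positivity)]
    have : (y : ℝ) ^ (-2 : ℝ) = (1 / y) ^ 2 := by
      rw [Real.rpow_neg hy0.le, one_div, inv_pow]; norm_cast
    rw [this]
    simp
  have hpres := Complex.volume_preserving_equiv_real_prod
  rw [volume_eq_lintegral]
  refine ne_of_lt (lt_of_le_of_lt (lintegral_mono_set hsub) ?_)
  have e := hpres.setLIntegral_comp_preimage_emb (MeasurableEquiv.measurableEmbedding _)
    (fun p : ℝ × ℝ => (((1 / ‖p.2‖₊) ^ 2 : NNReal) : ℝ≥0∞))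
    (Set.Icc (-(1 / 2)) (1 / 2) ×ˢ Set.Ioi (1 / 2))
  have e' : ∫⁻ z in Complex.measurableEquivRealProd ⁻¹'
      (Set.Icc (-(1 / 2)) (1 / 2) ×ˢ Set.Ioi (1 / 2)), (((1 / ‖z.im‖₊) ^ 2 : NNReal) : ℝ≥0∞) =
      ∫⁻ p in (Set.Icc (-(1 / 2)) (1 / 2) ×ˢ Set.Ioi (1 / 2) : Set (ℝ × ℝ)),
        (((1 / ‖p.2‖₊) ^ 2 : NNReal) : ℝ≥0∞) := e
  rw [e', Measure.volume_eq_prod, ← Measure.prod_restrict, lintegral_prod _ (by fun_prop)]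
  dsimp only
  rw [lintegral_const]
  exact ENNReal.mul_lt_top hC.lt_top (by simp)

/-- The boundary lies on the unit circle and two vertical lines. The lines are written as frontiers
of half-planes, since the frontier of a convex set is a null set. -/
lemma volume_fd_diff_fdo : volume (ModularGroup.fd \ ModularGroup.fdo) = 0 := by
  rw [volume_eq_lintegral]
  refine setLIntegral_measure_zero _ _ ?_
  have hsub : UpperHalfPlane.coe '' (ModularGroup.fd \ ModularGroup.fdo) ⊆
      Metric.sphere 0 1 ∪ (frontier {z : ℂ | z.re ≤ 1 / 2} ∪ frontier {z : ℂ | -(1 / 2) ≤ z.re}) := by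
    rintro _ ⟨τ, ⟨h1, h2⟩, rfl⟩
    rw [Complex.frontier_setOfPred_re_le, Complex.frontier_setOfPred_le_re]
    by_cases h : 1 < Complex.normSq τ
    · right
      have h3 : ¬ |τ.re| < 1 / 2 := fun h3 => h2 ⟨h, h3⟩
      have h4 : |τ.re| = 1 / 2 := le_antisymm h1.2 (not_lt.1 h3)
      rcases (abs_eq (by norm_num)).1 h4 with h5 | h5
      · exact Or.inl h5
      · exact Or.inr h5
    · left
      have h3 : Complex.normSq τ = 1 := le_antisymm (not_lt.1 h) h1.1
      rw [mem_sphere_zero_iff_norm, ← sq_eq_sq₀ (norm_nonneg _) zero_le_one,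
        ← Complex.normSq_eq_norm_sq, h3, one_pow]
  refine measure_mono_null hsub (measure_union_null (Measure.addHaar_sphere _ _ _)
    (measure_union_null ?_ ?_))
  · exact (convex_halfSpace_re_le _).addHaar_frontier _
  · exact (convex_halfSpace_re_ge _).addHaar_frontier _

instance : SigmaFinite muH := by
  unfold muH
  -- The normalizing constant is finite because the fundamental domain has positive area.
  have h : (volume ModularGroup.fd : ℝ≥0∞)⁻¹ ≠ ∞ := ENNReal.inv_ne_top.2 volume_fd_ne_zero
  lift (volume ModularGroup.fd : ℝ≥0∞)⁻¹ to NNReal using h with c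
  exact inferInstanceAs (SigmaFinite (c • (volume : Measure ℍ)))

lemma muH_fd : muH ModularGroup.fd = 1 := by
  rw [muH, Measure.smul_apply, smul_eq_mul,
    ENNReal.inv_mul_cancel volume_fd_ne_zero volume_fd_ne_top]

lemma measurePreserving_smul_muH (g : GQ) : MeasurePreserving (fun τ : ℍ => g • τ) muH muH := by
  have h : MeasurePreserving (fun τ : ℍ => g • τ) (volume : Measure ℍ) volume :=
    measurePreserving_smul
      ((Matrix.GeneralLinearGroup.map (n := Fin 2) (algebraMap ℚ ℝ)) g.toGL) (volume : Measure ℍ)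
  exact h.smul_measure _

/-! ### Generic points of the upper half plane -/

instance : Countable GQ := by
  have : Function.Injective fun g : GQ => (g.toGL : Matrix (Fin 2) (Fin 2) ℚ) :=
    fun g h e => Subtype.ext (Units.ext e)
  have : Countable (Matrix (Fin 2) (Fin 2) ℚ) := inferInstanceAs (Countable (Fin 2 → Fin 2 → ℚ))
  exact Function.Injective.countable ‹_›

instance : Countable SL(2, ℤ) := ofSL_injective.countable

/-- The points of `ℍ` none of whose translates is on the boundary of the fundamental domain. -/
def genericH : Set ℍ := {τ | ∀ g : GQ, g • τ ∉ ModularGroup.fd \ ModularGroup.fdo}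

/-- A countable union of translates of a null set is null. All of `GL₂⁺(ℚ)` is used, not only `Γ`,
since the points `t τ` must avoid the boundary as well. -/
lemma ae_genericH : ∀ᵐ τ ∂muH, τ ∈ genericH := by
  refine ae_all_iff.2 fun g => ?_
  have h0 : muH (ModularGroup.fd \ ModularGroup.fdo) = 0 := by
    rw [muH, Measure.smul_apply, volume_fd_diff_fdo, smul_zero]
  exact measure_eq_zero_iff_ae_notMem.1
    ((measurePreserving_smul_muH g).quasiMeasurePreserving.preimage_null h0)

/-- Two elements of `Γ` that move `t τ` into the fundamental domain differ by `±1`, as the image is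
an interior point; both signs occur since `-1` acts trivially on `ℍ`. -/
lemma exists_forall_smul_mem_fd {τ : ℍ} (hτ : τ ∈ genericH) (t : GQ) :
    ∃ a : SL(2, ℤ), ∀ γ : SL(2, ℤ), (ofSL γ * t) • τ ∈ ModularGroup.fd ↔ γ = a ∨ γ = -a := by
  obtain ⟨a, ha⟩ := ModularGroup.exists_smul_mem_fd (t • τ)
  have hgen : ∀ γ : SL(2, ℤ), γ • t • τ ∈ ModularGroup.fd → γ • t • τ ∈ ModularGroup.fdo := by
    intro γ h
    by_contra h'
    refine hτ (ofSL γ * t) ?_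
    rw [mul_smul, ofSL_smul]
    exact ⟨h, h'⟩
  refine ⟨a, fun γ => ?_⟩
  rw [mul_smul, ofSL_smul]
  constructor
  · intro h
    have h1 : (γ * a⁻¹) • a • t • τ ∈ ModularGroup.fd := by
      rwa [smul_smul, inv_mul_cancel_right]
    rcases ModularGroup.eq_one_or_neg_one_of_mem_fdo_mem_fd (hgen a ha) h1 with h2 | h2
    · exact Or.inl (mul_inv_eq_one.1 h2)
    · right
      rw [mul_inv_eq_iff_eq_mul.1 h2, neg_one_mul]
  · rintro (rfl | rfl)
    · exact ha
    · rwa [ModularGroup.SL_neg_smul]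

/-- The measure `dρ × dμ(τ)` on `Y`. -/
def nu : Measure Y := haarM2.prod muH

instance : SigmaFinite nu := inferInstanceAs (SigmaFinite (haarM2.prod muH))

lemma ae_generic : ∀ᵐ y ∂nu, y.2 ∈ genericH :=
  Measure.quasiMeasurePreserving_snd.ae ae_genericH

/-- The set of the `y` in `Y` with `g y` in `Y`. -/
def domY (g : GQ) : Set Y := {y | InM2 g y.1}

lemma mem_domY {g : GQ} {y : Y} : y ∈ domY g ↔ InM2 g y.1 := Iff.rfl

lemma domY_eq (g : GQ) : domY g = domM g ×ˢ Set.univ := by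
  ext y; simp [mem_domY, mem_domM]

lemma isClopen_domY (g : GQ) : IsClopen (domY g) := (isClopen_inM2 g).preimage continuous_fst

lemma measurableSet_domY (g : GQ) : MeasurableSet (domY g) := (isClopen_domY g).isOpen.measurableSet

/-- The partial action of `g` on `Y`, extended to all of `Y`. -/
def actExt (g : GQ) : Y → Y := Prod.map (gmulExt g) (fun τ => g • τ)

lemma measurable_actExt (g : GQ) : Measurable (actExt g) :=
  (measurable_gmulExt g).prodMap (continuous_smul_H g).measurable

lemma actExt_of {g : GQ} {y : Y} (h : InM2 g y.1) : actExt g y = act g y h :=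
  Prod.ext (gmulExt_of h) rfl

/-- The whole Jacobian comes from `M₂(R)`, because `GL₂⁺(ℚ)` acts on `ℍ` by isometries. -/
lemma map_actExt (g : GQ) :
    (nu.restrict (domY g)).map (actExt g) = ENNReal.ofReal g.det ^ 2 • nu.restrict (domY g⁻¹) := by
  unfold nu actExt
  rw [domY_eq, domY_eq, ← Measure.prod_restrict, ← Measure.prod_restrict, Measure.restrict_univ,
    ← Measure.map_prod_map _ _ (measurable_gmulExt g) (continuous_smul_H g).measurable,
    map_gmulExt, (measurePreserving_smul_muH g).map_eq, Measure.prod_smul_left]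

/-! ### Integration over `X` of sums over `Γ \ G_y` -/

/-- The part of `Y` over the standard fundamental domain. -/
def domX : Set Y := Set.univ ×ˢ ModularGroup.fd

lemma mem_domX {y : Y} : y ∈ domX ↔ y.2 ∈ ModularGroup.fd := by simp [domX]

lemma measurableSet_domX : MeasurableSet domX :=
  MeasurableSet.univ.prod ModularGroup.isClosed_fd.measurableSet

lemma nu_domX : nu domX = 1 := by
  rw [nu, domX, Measure.prod_prod, measure_univ, muH_fd, one_mul]

instance : IsProbabilityMeasure (nu.restrict domX) :=
  ⟨by rw [Measure.restrict_apply_univ, nu_domX]⟩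

open Classical in
/-- The function `y ↦ k(g, y)`, extended by zero. -/
def kext (k : Z → ℂ) (g : GQ) (y : Y) : ℂ := if h : InM2 g y.1 then k (mk g y h) else 0

lemma kext_of {k : Z → ℂ} {g : GQ} {y : Y} (h : InM2 g y.1) : kext k g y = k (mk g y h) :=
  dif_pos h

lemma kext_of_not {k : Z → ℂ} {g : GQ} {y : Y} (h : ¬ InM2 g y.1) : kext k g y = 0 := dif_neg h

lemma kext_ofSL_mul (k : Z → ℂ) (γ : SL(2, ℤ)) (g : GQ) (y : Y) :
    kext k (ofSL γ * g) y = kext k g y := by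
  by_cases h : InM2 g y.1
  · rw [kext_of h, kext_of (inM2_ofSL_act γ h)]
    exact congrArg k (mk_eq γ 1 (by simp) (one_smul _ _).symm _ _)
  · rw [kext_of_not h, kext_of_not]
    intro h'
    refine h ?_
    have := inM2_ofSL_act γ⁻¹ h'
    rwa [map_inv, inv_mul_cancel_left] at this

lemma measurable_kext (f : 𝒜) (g : GQ) : Measurable (kext f g) := by
  classical
  exact Measurable.dite (s := {y : Y | InM2 g y.1})
    (f.continuous.comp (continuous_mk_left g)).measurable measurable_const (measurableSet_domY g)

lemma exists_norm_kext_le (f : 𝒜) : ∃ C : ℝ, 0 ≤ C ∧ ∀ g y, ‖kext f g y‖ ≤ C := by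
  obtain ⟨C, hC⟩ := f.hasCompactSupport.exists_bound_of_continuous f.continuous
  refine ⟨max C 0, le_max_right _ _, fun g y => ?_⟩
  by_cases h : InM2 g y.1
  · rw [kext_of h]
    exact (hC _).trans (le_max_left _ _)
  · rw [kext_of_not h, norm_zero]
    exact le_max_right _ _

lemma integrable_kext (f : 𝒜) (g : GQ) : Integrable (kext f g) (nu.restrict domX) := by
  obtain ⟨C, -, hC⟩ := exists_norm_kext_le f
  exact .of_bound (measurable_kext f g).aestronglyMeasurable C (.of_forall fun y => hC g y)

/-- A finite set of representatives of distinct classes of `Γ \ GL₂⁺(ℚ)`, whose classes contain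
all the `g` such that `k(g, y)` is non-zero for some `y`. -/
structure IsRepsFor (k : Z → ℂ) (T : Finset GQ) : Prop where
  distinct : ∀ t ∈ T, ∀ t' ∈ T, leftRel t t' → t = t'
  exists_rel : ∀ g y, kext k g y ≠ 0 → ∃ t ∈ T, leftRel t g

lemma exists_isRepsFor (f : 𝒜) : ∃ T, IsRepsFor f T := by
  obtain ⟨T₀, hT₀⟩ := exists_finset f
  obtain ⟨T, hT, hT'⟩ := exists_distinct T₀
  refine ⟨T, hT', fun g y h => hT g ?_⟩
  by_cases hg : InM2 g y.1
  · rw [kext_of hg] at h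
    exact (hT₀ _ _ _ h).1
  · exact absurd (kext_of_not hg) h

/-- The sum of `k(g, y)` over the classes of the `g` in `Γ \ G_y`. -/
def cosetSum (k : Z → ℂ) (y : Y) : ℂ := ∑' j : Coset y, k (pt y j (clsOne y))

lemma cosetSum_eq {k : Z → ℂ} {T : Finset GQ} (hT : IsRepsFor k T) (y : Y) :
    cosetSum k y = ∑ t ∈ T, kext k t y := by
  classical
  rw [cosetSum, tsum_coset T hT.distinct y _ (fun g hg hne => ?_) (T.filter fun t => InM2 t y.1)
    (fun t => Finset.mem_filter)]
  · unfold kext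
    rw [Finset.sum_dite, Finset.sum_const_zero, add_zero]
    exact Finset.sum_congr rfl fun t _ => by rw [pt_clsOne]
  · rw [pt_clsOne] at hne
    exact hT.exists_rel g y (by rwa [kext_of hg])

lemma ne_neg_SL (a : SL(2, ℤ)) : a ≠ -a := by
  intro h
  have h1 : ∀ i j, a.1 i j = 0 := fun i j => by
    have h2 : a.1 i j = -a.1 i j := congrArg (fun b : SL(2, ℤ) => b.1 i j) h
    lia
  have h3 := a.2
  rw [Matrix.det_fin_two, h1, h1, h1] at h3
  simp at h3

-- This unfolds a sum over `Γ \ GL₂⁺(ℚ)` into a sum over the group, each class contributing its two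
-- representatives that move `τ` into the fundamental domain. The values are left general because
-- the formula serves twice: in `ℂ` for the identity, and in `ℝ≥0∞` for the domination.
open Classical in
lemma tsum_fd {α : Type*} [AddCommMonoid α] [TopologicalSpace α] [T2Space α] {τ : ℍ}
    (hτ : τ ∈ genericH) {T : Finset GQ} (hT : ∀ t ∈ T, ∀ t' ∈ T, leftRel t t' → t = t')
    {w : GQ → α} (hw : ∀ γ g, w (ofSL γ * g) = w g) (hw' : ∀ g, w g ≠ 0 → ∃ t ∈ T, leftRel t g) :
    ∑' g : GQ, (if g • τ ∈ ModularGroup.fd then w g else 0) = 2 • ∑ t ∈ T, w t := by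
  choose a ha using exists_forall_smul_mem_fd hτ
  have hdisj : (T : Set GQ).PairwiseDisjoint
      fun t => ({ofSL (a t) * t, ofSL (-(a t)) * t} : Finset GQ) := by
    intro t ht t' ht' hne
    refine Finset.disjoint_left.2 fun g hg hg' => hne (hT t ht t' ht' ?_)
    have h1 : ∀ t : GQ, g ∈ ({ofSL (a t) * t, ofSL (-(a t)) * t} : Finset GQ) → leftRel t g := by
      intro t h
      rcases Finset.mem_insert.1 h with h | h
      · exact ⟨_, h⟩
      · exact ⟨_, Finset.mem_singleton.1 h⟩
    exact leftRel.trans (h1 t hg) (leftRel.symm (h1 t' hg'))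
  rw [tsum_eq_sum (s := T.biUnion fun t => {ofSL (a t) * t, ofSL (-(a t)) * t}),
    Finset.sum_biUnion hdisj, Finset.smul_sum]
  · refine Finset.sum_congr rfl fun t ht => ?_
    have hne : ofSL (a t) * t ≠ ofSL (-(a t)) * t := fun h =>
      ne_neg_SL (a t) (ofSL_injective (mul_right_cancel h))
    rw [Finset.sum_pair hne, if_pos ((ha t _).2 (Or.inl rfl)), if_pos ((ha t _).2 (Or.inr rfl)), hw,
      hw, two_nsmul]
  · intro g hg
    split_ifs with h
    · by_contra hne
      obtain ⟨t, ht, γ, rfl⟩ := hw' g hne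
      refine hg (Finset.mem_biUnion.2 ⟨t, ht, ?_⟩)
      rcases (ha t γ).1 h with rfl | rfl <;> simp
    · rfl

/-- The integral over `X` of the sum of `f(g, y)` over the classes of the `g` in `Γ \ G_y`. -/
def sumInt (f : 𝒜) : ℂ := ∫ y in domX, cosetSum f y ∂nu

lemma sumInt_eq {f : 𝒜} {T : Finset GQ} (hT : IsRepsFor f T) :
    sumInt f = ∑ t ∈ T, ∫ y in domX, kext f t y ∂nu := by
  rw [sumInt, ← integral_finsetSum _ fun t _ => integrable_kext f t]
  exact integral_congr_ae (.of_forall fun y => cosetSum_eq hT y)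

open Classical in
/-- The function `k(g, y)` restricted to the pairs such that `g y` is over the fundamental
domain. -/
def kfd (k : Z → ℂ) (g : GQ) (y : Y) : ℂ := if g • y.2 ∈ ModularGroup.fd then kext k g y else 0

lemma measurable_kfd (f : 𝒜) (g : GQ) : Measurable (kfd f g) := by
  classical
  refine Measurable.ite ?_ (measurable_kext f g) measurable_const
  exact ((continuous_smul_H g).measurable.comp measurable_snd)
    ModularGroup.isClosed_fd.measurableSet

/-- The sum over classes treats `y` and `g y` differently; this form, in which both lie over the
fundamental domain, is the one on which inversion can act. -/
lemma two_mul_sumInt (f : 𝒜) : 2 * sumInt f = ∑' g : GQ, ∫ y in domX, kfd f g y ∂nu := by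
  classical
  obtain ⟨T, hT⟩ := exists_isRepsFor f
  obtain ⟨C, hC0, hC⟩ := exists_norm_kext_le f
  have hgen : ∀ᵐ y ∂nu.restrict domX, y.2 ∈ genericH := ae_restrict_of_ae ae_generic
  rw [← integral_tsum fun g => (measurable_kfd f g).aestronglyMeasurable, sumInt,
    ← integral_const_mul]
  · refine integral_congr_ae ?_
    filter_upwards [hgen] with y hy
    rw [cosetSum_eq hT]
    have := tsum_fd hy hT.distinct (w := fun g => kext f g y) (fun γ g => kext_ofSL_mul f γ g y)
      (fun g => hT.exists_rel g y)
    rw [two_nsmul, ← two_mul] at this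
    exact this.symm
  -- Exchanging sum and integral: the sum of the norms is almost everywhere at most `2 · |T| · C`,
  -- and `domX` has measure one.
  · rw [← lintegral_tsum fun g => (measurable_kfd f g).enorm.aemeasurable]
    refine ne_of_lt (lt_of_le_of_lt (b := ∫⁻ y in domX, 2 • (T.card • ENNReal.ofReal C) ∂nu)
      (lintegral_mono_ae ?_) ?_)
    · filter_upwards [hgen] with y hy
      have := tsum_fd hy hT.distinct (w := fun g => ‖kext f g y‖ₑ)
        (fun γ g => by rw [kext_ofSL_mul])
        (fun g h => hT.exists_rel g y fun h0 => h (by rw [h0, enorm_zero]))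
      have e : ∀ g, ‖kfd f g y‖ₑ = if g • y.2 ∈ ModularGroup.fd then ‖kext f g y‖ₑ else 0 := by
        intro g
        unfold kfd
        split_ifs <;> simp
      simp only [e]
      rw [this]
      refine nsmul_le_nsmul_right (Finset.sum_le_card_nsmul _ _ _ fun t _ => ?_) 2
      rw [← ofReal_norm]
      exact ENNReal.ofReal_le_ofReal (hC t y)
    · rw [lintegral_const, measure_univ, mul_one]
      simp [ENNReal.mul_lt_top]

/-! ### Inversion of `Z` and the factor `det⁻²` -/

/-- The function `(g, y) ↦ f(g⁻¹, g y)`. -/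
def flip (f : 𝒜) : 𝒜 where
  toFun z := f (invZ z)
  continuous_toFun := f.continuous.comp continuous_invZ
  hasCompactSupport' := f.hasCompactSupport.comp_homeomorph invHomeo

lemma flip_apply (f : 𝒜) (z : Z) : flip f z = f (invZ z) := rfl

/-- Substitute `y' = g y`. The conditions that `y` and `g y` lie over the fundamental domain become
those for `g⁻¹ y'` and `y'`, and the Jacobian is `(det g)²`. -/
lemma integral_kfd_flip (f : 𝒜) (g : GQ) :
    ∫ y in domX, kfd (flip f) g y ∂nu = (g.det : ℂ) ^ 2 * ∫ y in domX, kfd f g⁻¹ y ∂nu := by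
  classical
  have e1 : ∀ y, domX.indicator (kfd (flip f) g) y =
      (domY g).indicator (fun y => domX.indicator (kfd f g⁻¹) (actExt g y)) y := by
    intro y
    by_cases h : InM2 g y.1
    · rw [Set.indicator_of_mem (mem_domY.2 h)]
      have hk : kext (flip f) g y = kext f g⁻¹ (actExt g y) := by
        have h' : InM2 g⁻¹ (actExt g y).1 := by rw [actExt_of h]; exact inM2_inv_act h
        rw [kext_of h, kext_of h', flip_apply, invZ_mk]
        exact congrArg f (mk_congr rfl (actExt_of h).symm _ _)
      have h2 : (actExt g y).2 = g • y.2 := rfl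
      -- The two membership conditions are exchanged; `inv_smul_smul` recovers the condition on `y`
      -- from the one on `g⁻¹ (g y)`.
      simp only [Set.indicator_apply, kfd, mem_domX, h2, inv_smul_smul, hk]
      split_ifs <;> rfl
    · rw [Set.indicator_of_notMem fun h' => h (mem_domY.1 h')]
      simp only [Set.indicator_apply, kfd, kext_of_not h]
      split_ifs <;> rfl
  have hm : Measurable (domX.indicator (kfd f g⁻¹)) :=
    (measurable_kfd f g⁻¹).indicator measurableSet_domX
  have e2 : ∀ y, (domY g⁻¹).indicator (domX.indicator (kfd f g⁻¹)) y =
      domX.indicator (kfd f g⁻¹) y := by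
    intro y
    by_cases h : InM2 g⁻¹ y.1
    · rw [Set.indicator_of_mem (mem_domY.2 h)]
    · rw [Set.indicator_of_notMem fun h' => h (mem_domY.1 h')]
      simp only [Set.indicator_apply, kfd, kext_of_not h]
      split_ifs <;> rfl
  rw [← integral_indicator measurableSet_domX, integral_congr_ae (.of_forall e1),
    integral_indicator (measurableSet_domY g),
    ← integral_map (measurable_actExt g).aemeasurable hm.aestronglyMeasurable, map_actExt,
    integral_smul_measure, ← integral_indicator (measurableSet_domY g⁻¹),
    integral_congr_ae (.of_forall e2), integral_indicator measurableSet_domX, ENNReal.toReal_pow,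
    ENNReal.toReal_ofReal (det_pos g).le, Complex.real_smul, Complex.ofReal_pow]

/-- The determinant, as a function on `Z`. -/
def detZ : Z → ℝ :=
  Quotient.lift (fun x : D => x.1.1.det) (by
    rintro x' x ⟨⟨a, b⟩, rfl⟩
    change ((a, b) • x : D).1.1.det = x.1.1.det
    rw [smul_D_fst, det_mul, det_mul, det_inv, det_ofSL, det_ofSL]
    simp)

lemma detZ_pos (z : Z) : 0 < detZ z := by
  obtain ⟨x, rfl⟩ := Quotient.exists_rep z
  exact det_pos x.1.1

/-- The function `Det(g)^s f(g, y)`, for a complex number `s`. -/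
def detMul (s : ℂ) (f : 𝒜) : 𝒜 where
  toFun z := (detZ z : ℂ) ^ s * f z
  continuous_toFun := by
    refine Continuous.mul ?_ f.continuous
    refine isQuotientMap_quotient_mk'.continuous_iff.2 ?_
    exact (continuous_of_discreteTopology (f := fun g : GQ => (g.det : ℂ) ^ s)).comp
      (continuous_fst.comp continuous_subtype_val)
  hasCompactSupport' := f.hasCompactSupport.mono fun z hz hz' => hz (by simp [hz'])

lemma kext_detMul (s : ℂ) (f : 𝒜) (g : GQ) (y : Y) :
    kext (detMul s f) g y = (g.det : ℂ) ^ s * kext f g y := by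
  by_cases h : InM2 g y.1
  · rw [kext_of h, kext_of h]; rfl
  · rw [kext_of_not h, kext_of_not h, mul_zero]

/-- The failure of the trace property, measured exactly. Reindexing the unfolded sum by `g ↦ g⁻¹`
turns the Jacobian into `(det g)⁻²`; the factor 2 is cancelled at the start. -/
lemma sumInt_flip (f : 𝒜) : sumInt (flip f) = sumInt (detMul (-2) f) := by
  have h2 : (2 : ℂ) ≠ 0 := two_ne_zero
  refine mul_left_cancel₀ h2 ?_
  rw [two_mul_sumInt, two_mul_sumInt, ← (Equiv.inv GQ).tsum_eq]
  refine tsum_congr fun g => ?_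
  rw [Equiv.inv_apply, integral_kfd_flip, inv_inv, ← integral_const_mul]
  refine integral_congr_ae (.of_forall fun y => ?_)
  simp only [kfd, kext_detMul]
  rw [mul_ite, mul_zero, det_inv, Complex.ofReal_inv, Complex.cpow_neg, Complex.cpow_ofNat,
    inv_pow]

/-- The set `T` does not depend on `s`, so the dependence on `s` is through finitely many
exponentials. -/
lemma sumInt_detMul {f : 𝒜} {T : Finset GQ} (hT : IsRepsFor f T) (s : ℂ) :
    sumInt (detMul s f) = ∑ t ∈ T, (t.det : ℂ) ^ s * ∫ y in domX, kext f t y ∂nu := by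
  have h : IsRepsFor (detMul s f) T :=
    ⟨hT.distinct, fun g y hne => hT.exists_rel g y fun h0 => hne (by rw [kext_detMul, h0, mul_zero])⟩
  rw [sumInt_eq h]
  refine Finset.sum_congr rfl fun t _ => ?_
  simp only [kext_detMul]
  exact integral_const_mul _ _

/-! ### The state -/

lemma measurable_unitVal (f : 𝒜) : Measurable (unitVal f) := by
  refine measurable_from_quotient.2 ?_
  have e : unitVal f ∘ Quotient.mk'' = kext f 1 := funext fun y => (kext_of (inM2_one y.1)).symm
  rw [e]
  exact measurable_kext f 1

lemma muX_eq : muX = (nu.restrict domX).map (Quotient.mk _) := rfl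

instance : IsProbabilityMeasure muX := by
  rw [muX_eq]
  exact Measure.isProbabilityMeasure_map measurable_quotient_mk''.aemeasurable

/-- `f(1, y)` is the matrix coefficient of `π_y(f)` at the unit vector of the class of `1`. -/
lemma norm_kext_one_le (f : 𝒜) (y : Y) : ‖kext f 1 y‖ ≤ ‖toA f‖ := by
  classical
  have e : kext f 1 y = rep f y (lp.single 2 (clsOne y) (1 : ℂ)) (clsOne y) := by
    rw [rep_single, kext_of (inM2_one y.1)]
    exact congrArg f (pt_clsOne y 1 (inM2_one y.1)).symm
  rw [e]
  have h1 : ‖(lp.single 2 (clsOne y) (1 : ℂ) : Hy y)‖ = 1 := by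
    rw [lp.norm_single (by simp), norm_one]
  have h2 : ‖rep f y‖ ≤ ‖toA f‖ :=
    lp.norm_apply_le_norm (E := fun y : Y => Hy y →L[ℂ] Hy y) ENNReal.top_ne_zero (piAll f) y
  refine (lp.norm_apply_le_norm (by simp) _ _).trans ((ContinuousLinearMap.le_opNorm _ _).trans ?_)
  rwa [h1, mul_one]

lemma integral_unitVal (f : 𝒜) : ∫ x, unitVal f x ∂muX = ∫ y in domX, kext f 1 y ∂nu := by
  rw [muX_eq, integral_map measurable_quotient_mk''.aemeasurable
    (measurable_unitVal f).aestronglyMeasurable]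
  exact integral_congr_ae (.of_forall fun y => (kext_of (inM2_one y.1)).symm)

lemma integrable_unitVal (f : 𝒜) : Integrable (unitVal f) muX := by
  refine .of_bound (measurable_unitVal f).aestronglyMeasurable ‖toA f‖ (.of_forall fun x => ?_)
  obtain ⟨y, rfl⟩ := Quotient.exists_rep x
  have := norm_kext_one_le f y
  rwa [kext_of (inM2_one y.1)] at this

/-- The linear form `f ↦ ∫ f(1, y) dy` on `𝒜`. -/
def phi0 : 𝒜 →ₗ[ℂ] ℂ where
  toFun f := ∫ y in domX, kext f 1 y ∂nu
  map_add' f g := by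
    rw [← integral_add (integrable_kext f 1) (integrable_kext g 1)]
    refine integral_congr_ae (.of_forall fun y => ?_)
    simp only [kext_of (inM2_one y.1)]
    rfl
  map_smul' c f := by
    rw [RingHom.id_apply, ← integral_smul]
    refine integral_congr_ae (.of_forall fun y => ?_)
    simp only [kext_of (inM2_one y.1)]
    rfl

/-- The canonical map `𝒜 → A`, as a linear map. -/
def toAL : 𝒜 →ₗ[ℂ] A where
  toFun := toA
  map_add' f g := Subtype.ext (piAll_add f g)
  map_smul' c f := Subtype.ext (piAll_smul c f)

lemma norm_phi0_le (f : 𝒜) : ‖phi0 f‖ ≤ 1 * ‖toAL f‖ := by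
  have := norm_integral_le_of_norm_le_const (μ := nu.restrict domX)
    (.of_forall fun y => norm_kext_one_le f y)
  rw [probReal_univ, mul_one] at this
  rw [one_mul]
  exact this

/-- The extension to `A` of the linear form `f ↦ ∫ f(1, y) dy`. -/
def phi : A →L[ℂ] ℂ := phi0.extendOfNorm toAL

lemma phi_toA (f : 𝒜) : phi (toA f) = phi0 f :=
  LinearMap.extendOfNorm_eq (e := toAL) denseRange_toA ⟨1, norm_phi0_le⟩ f

lemma norm_phi_apply_le (a : A) : ‖phi a‖ ≤ ‖a‖ := by
  have := LinearMap.norm_extendOfNorm_apply_le (e := toAL) denseRange_toA 1 norm_phi0_le a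
  rwa [one_mul] at this

/-- The product on the right is pointwise. The term `f(h⁻¹, h y)` of the convolution at `1` is the
value of `f` at the inverse of the point `(h, y)` of `Z`. -/
lemma phi0_conv (f g : 𝒜) : phi0 (conv f g) = sumInt (flip f * g) := by
  refine integral_congr_ae (.of_forall fun y => ?_)
  simp only [kext_of (inM2_one y.1)]
  change convFun f g (mk 1 y (inM2_one y.1)) = _
  rw [convFun_mk]
  refine tsum_congr fun j => ?_
  rw [CompactlySupportedContinuousMap.mul_apply, flip_apply, invZ_pt]
  rfl

-- By density it suffices to treat `f` in `𝒜`. There `flip (invol f)` is the complex conjugate of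
-- `f`, so the function being summed is `|f|²`.
open scoped ComplexOrder in
lemma phi_star_mul_self_nonneg (a : A) : 0 ≤ phi (star a * a) := by
  have h1 : Continuous fun a : A => star a * a := by fun_prop
  have h2 : Continuous fun a : A => phi (star a * a) := phi.continuous.comp h1
  have hc : IsClosed {a : A | 0 ≤ phi (star a * a)} := isClosed_le continuous_const h2
  refine denseRange_toA.induction_on (p := fun a => 0 ≤ phi (star a * a)) a hc fun f => ?_
  rw [← toA_invol, ← toA_conv, phi_toA, phi0_conv]
  obtain ⟨T, hT⟩ := exists_isRepsFor (flip (invol f) * f)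
  rw [sumInt_eq hT]
  refine Finset.sum_nonneg fun t _ => ?_
  have e : ∀ y, kext (⇑(flip (invol f) * f)) t y = ((‖kext f t y‖ ^ 2 : ℝ) : ℂ) := by
    intro y
    by_cases h : InM2 t y.1
    · rw [kext_of h, kext_of h, CompactlySupportedContinuousMap.mul_apply, flip_apply]
      change star (f (invZ (invZ _))) * _ = _
      rw [invZ_invZ, mul_comm, Complex.star_def, Complex.mul_conj, Complex.normSq_eq_norm_sq]
    · rw [kext_of_not h, kext_of_not h]; simp
  rw [integral_congr_ae (.of_forall e), integral_complex_ofReal]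
  exact Complex.zero_le_real.2 (integral_nonneg fun y => sq_nonneg _)

/-! ### The norm of the state -/

/-- This serves for the compactly supported Urysohn function in `muH_truncated_le`. -/
instance : LocallyCompactSpace Z :=
  IsOpenQuotientMap.locallyCompactSpace
    ⟨Quotient.mk_surjective, continuous_mk, isOpenMap_mk⟩

/-- The set of the classes in `Z` of the pairs `(γ, y)` with `γ` in `Γ`. -/
def unitZ : Set Z := (Quotient.mk _ : D → Z) '' {x | x.1.1 ∈ Set.range ofSL}

lemma isOpen_unitZ : IsOpen unitZ :=
  isOpenMap_mk _ ((isOpen_discrete (Set.range ofSL)).preimage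
    (continuous_fst.comp continuous_subtype_val))

lemma eq_of_pt_mem_unitZ {y : Y} (i j : Coset y) : pt y i j ∈ unitZ → i = j := by
  revert i j
  refine coset_ind fun g hg => coset_ind fun k hk h => ?_
  obtain ⟨x, ⟨γ, hγ⟩, e⟩ := h
  rw [pt_cls] at e
  obtain ⟨a, b, e1, -⟩ := mk_eq_iff.1 (e.symm : _ = mk x.1.1 x.1.2 x.2)
  refine cls_eq.2 (leftRel.symm ⟨a * γ * b⁻¹, ?_⟩)
  rw [map_mul, map_mul, map_inv, hγ, ← e1, inv_mul_cancel_right]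

/-- A function supported in `unitZ` acts by diagonal matrices in every `π_y`, so its norm is
controlled by its sup norm. -/
lemma norm_toA_le_one {f : 𝒜} (h1 : ∀ z, ‖f z‖ ≤ 1) (h2 : ∀ z ∉ unitZ, f z = 0) : ‖toA f‖ ≤ 1 := by
  rw [norm_toA]
  have hk : ∀ y : Y, ∀ i j : Coset y, f (pt y i j) ≠ 0 → i = j := fun y i j hne =>
    eq_of_pt_mem_unitZ i j (not_not.1 fun h => hne (h2 _ h))
  refine Real.iSup_le (fun y => ?_) zero_le_one
  have h : IsFinKernel 1 1 fun i j : Coset y => f (pt y i j) :=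
    ⟨fun i j => h1 _, fun i => ⟨{i}, by simp, fun j hj => by simp [hk y i j hj]⟩,
      fun j => ⟨{j}, by simp, fun i hi => by simp [hk y i j hi]⟩⟩
  simpa using norm_op_le zero_le_one h (rep_apply f y)

/-- Functions approximating the unit: take `u` with values in `[0, 1]`, supported in `unitZ` and
equal to `1` at `(1, y)` for `y` over the truncated domain. Its norm in `A` is at most one, while
`φ` takes on it at least the measure of that domain. The truncation provides compactness, since `X`
itself has a cusp. -/
lemma muH_truncated_le (n : ℕ) :
    (muH (ModularGroup.truncatedFundamentalDomain n)).toReal ≤ ‖phi‖ := by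
  set L : Set Y := Set.univ ×ˢ ModularGroup.truncatedFundamentalDomain n with hL
  have hLc : IsCompact L :=
    isCompact_univ.prod (ModularGroup.isCompact_truncatedFundamentalDomain n)
  have hLd : L ⊆ domX := Set.prod_mono le_rfl fun τ hτ => hτ.1
  have hc : Continuous fun y : Y => mk 1 y (inM2_one y.1) :=
    continuous_mk.comp (Continuous.subtype_mk (continuous_const.prodMk continuous_id) _)
  have hd : Disjoint ((fun y : Y => mk 1 y (inM2_one y.1)) '' L) unitZᶜ := by
    rw [Set.disjoint_compl_right_iff_subset]
    rintro _ ⟨y, -, rfl⟩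
    exact ⟨_, ⟨1, map_one _⟩, rfl⟩
  obtain ⟨u, hu1, hu0, hus, hu⟩ := exists_continuous_one_zero_of_isCompact (hLc.image hc)
    isOpen_unitZ.isClosed_compl hd
  let f : 𝒜 := ⟨⟨fun z => (u z : ℂ), Complex.continuous_ofReal.comp u.continuous⟩,
    hus.comp_left (g := fun r : ℝ => (r : ℂ)) Complex.ofReal_zero⟩
  have hf : ∀ z, f z = (u z : ℂ) := fun _ => rfl
  have hn : ‖toA f‖ ≤ 1 := by
    refine norm_toA_le_one (fun z => ?_) fun z hz => ?_
    · rw [hf, Complex.norm_real, Real.norm_of_nonneg (hu z).1]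
      exact (hu z).2
    · rw [hf, hu0 hz]; simp
  have hv : phi (toA f) = ((∫ y in domX, u (mk 1 y (inM2_one y.1)) ∂nu : ℝ) : ℂ) := by
    rw [phi_toA]
    refine Eq.trans ?_ integral_ofReal
    exact integral_congr_ae (.of_forall fun y => kext_of (inM2_one y.1))
  have hi : Integrable (fun y : Y => u (mk 1 y (inM2_one y.1))) (nu.restrict domX) := by
    refine .of_bound (u.continuous.comp hc).aestronglyMeasurable 1 (.of_forall fun y => ?_)
    rw [Real.norm_of_nonneg (hu _).1]
    exact (hu _).2
  have hle : (nu L).toReal ≤ ∫ y in domX, u (mk 1 y (inM2_one y.1)) ∂nu := by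
    calc (nu L).toReal = ∫ y in L, u (mk 1 y (inM2_one y.1)) ∂nu := by
          rw [setIntegral_congr_fun (g := fun _ => (1 : ℝ)) hLc.measurableSet
            fun y hy => hu1 ⟨y, hy, rfl⟩]
          simp [Measure.real]
      _ ≤ _ := setIntegral_mono_set hi (.of_forall fun y => (hu _).1)
        (Filter.Eventually.of_forall hLd)
  have hnu : nu L = muH (ModularGroup.truncatedFundamentalDomain n) := by
    rw [nu, hL, Measure.prod_prod, measure_univ, one_mul]
  rw [← hnu]
  calc (nu L).toReal ≤ ‖phi (toA f)‖ := by
        rw [hv, Complex.norm_real]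
        exact hle.trans (le_abs_self _)
    _ ≤ ‖phi‖ * ‖toA f‖ := phi.le_opNorm _
    _ ≤ ‖phi‖ := mul_le_of_le_one_right (norm_nonneg _) hn

lemma norm_phi : ‖phi‖ = 1 := by
  refine le_antisymm (phi.opNorm_le_bound zero_le_one fun a => ?_) ?_
  · rw [one_mul]; exact norm_phi_apply_le a
  -- The truncated domains exhaust the fundamental domain, so their measures increase to 1.
  · have hmono : Monotone fun n : ℕ => ModularGroup.truncatedFundamentalDomain n :=
      fun m n h τ hτ => ⟨hτ.1, hτ.2.trans (Nat.cast_le.2 h)⟩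
    have hU : (⋃ n : ℕ, ModularGroup.truncatedFundamentalDomain n) = ModularGroup.fd := by
      ext τ
      rw [Set.mem_iUnion]
      exact ⟨fun ⟨n, h⟩ => h.1, fun h => (exists_nat_ge τ.im).imp fun n hn => ⟨h, hn⟩⟩
    have h := tendsto_measure_iUnion_atTop (μ := muH) hmono
    rw [hU, muH_fd] at h
    have h2 := (ENNReal.tendsto_toReal ENNReal.one_ne_top).comp h
    rw [ENNReal.toReal_one] at h2
    exact le_of_tendsto' h2 muH_truncated_le

lemma isState_phi : IsState phi := ⟨norm_phi, phi_star_mul_self_nonneg⟩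

/-! ### The KMS condition -/

/-- The closed strip `0 ≤ Im z ≤ 2`. -/
def strip : Set ℂ := {z | 0 ≤ z.im ∧ z.im ≤ 2}

/-- The functions which appear in the KMS condition for `a` and `b`. -/
structure IsKMSFun (a b : A) (F : ℂ → ℂ) : Prop where
  continuousOn : ContinuousOn F strip
  differentiableOn : DifferentiableOn ℂ F {z | 0 < z.im ∧ z.im < 2}
  bounded : ∃ C : ℝ, ∀ z ∈ strip, ‖F z‖ ≤ C
  bottom : ∀ t : ℝ, F t = phi (a * sigma t b)
  top : ∀ t : ℝ, F (t + Complex.I * 2) = phi (sigma t b * a)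

/-- The three lines theorem, as a case of the Phragmén–Lindelöf principle. -/
lemma norm_le_of_boundary {F : ℂ → ℂ} (hc : ContinuousOn F strip)
    (hd : DifferentiableOn ℂ F {z | 0 < z.im ∧ z.im < 2}) (hb : ∃ C : ℝ, ∀ z ∈ strip, ‖F z‖ ≤ C)
    {C : ℝ} (h0 : ∀ t : ℝ, ‖F t‖ ≤ C) (h2 : ∀ t : ℝ, ‖F (t + Complex.I * 2)‖ ≤ C) {z : ℂ}
    (hz : z ∈ strip) : ‖F z‖ ≤ C := by
  obtain ⟨B, hB⟩ := hb
  have hcl : closure (Complex.im ⁻¹' Set.Ioo 0 2) = strip := by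
    rw [Complex.closure_preimage_im, closure_Ioo (by norm_num)]; rfl
  refine PhragmenLindelof.horizontal_strip (a := 0) (b := 2) ⟨hd, by rwa [hcl]⟩
    -- With both growth constants zero, the growth condition says that `F` is `O(1)`, which is the
    -- assumed boundedness.
    ⟨0, by positivity, 0, ?_⟩ (fun w hw => ?_) (fun w hw => ?_) hz.1 hz.2
  · refine Asymptotics.IsBigO.of_bound B ?_
    refine Filter.Eventually.filter_mono inf_le_right ?_
    refine Filter.eventually_principal.2 fun w hw => ?_
    simpa using hB w ⟨hw.1.le, hw.2.le⟩
  · have : w = (w.re : ℂ) := Complex.ext rfl (by simpa using hw)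
    rw [this]; exact h0 _
  · have : w = (w.re : ℂ) + Complex.I * 2 := Complex.ext (by simp) (by simpa using hw)
    rw [this]; exact h2 _

lemma norm_sigma (t : ℝ) (b : A) : ‖sigma t b‖ = ‖b‖ := StarAlgEquiv.norm_map (sigma t) b

lemma sigma_sub (t : ℝ) (a b : A) : sigma t (a - b) = sigma t a - sigma t b := map_sub _ _ _

lemma continuous_sigma (t : ℝ) : Continuous (sigma t) :=
  (AddMonoidHomClass.isometry_of_norm (sigma t) (norm_sigma t)).continuous

/-- On the boundary, `F - G` is `φ` of a difference of products. As `φ` has norm at most one and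
`σ_t` is isometric, the same bound holds on both lines, independently of `t`, and so it holds inside
the strip. -/
lemma IsKMSFun.norm_sub_le {a b a' b' : A} {F G : ℂ → ℂ} (hF : IsKMSFun a b F)
    (hG : IsKMSFun a' b' G) {z : ℂ} (hz : z ∈ strip) :
    ‖F z - G z‖ ≤ ‖a‖ * ‖b - b'‖ + ‖a - a'‖ * ‖b'‖ := by
  refine norm_le_of_boundary (F := fun z => F z - G z) (hF.continuousOn.sub hG.continuousOn)
    (hF.differentiableOn.sub hG.differentiableOn) ?_ (fun t => ?_) (fun t => ?_) hz
  · obtain ⟨B, hB⟩ := hF.bounded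
    obtain ⟨C, hC⟩ := hG.bounded
    exact ⟨B + C, fun z hz => (_root_.norm_sub_le _ _).trans (add_le_add (hB z hz) (hC z hz))⟩
  · have e : a * sigma t b - a' * sigma t b' =
        a * sigma t (b - b') + (a - a') * sigma t b' := by
      rw [sigma_sub, mul_sub, sub_mul]; abel
    rw [hF.bottom, hG.bottom, ← map_sub, e]
    refine (norm_phi_apply_le _).trans ((norm_add_le _ _).trans ?_)
    refine add_le_add ((norm_mul_le _ _).trans ?_) ((norm_mul_le _ _).trans ?_) <;>
      rw [norm_sigma]
  · have e : sigma t b * a - sigma t b' * a' =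
        sigma t (b - b') * a + sigma t b' * (a - a') := by
      rw [sigma_sub, mul_sub, sub_mul]; abel
    rw [hF.top, hG.top, ← map_sub, e]
    refine (norm_phi_apply_le _).trans ((norm_add_le _ _).trans ?_)
    refine add_le_add ((norm_mul_le _ _).trans ?_) ((norm_mul_le _ _).trans ?_) <;>
      rw [norm_sigma, mul_comm]

/-- The estimate `IsKMSFun.norm_sub_le` makes the sequence uniformly Cauchy on the strip; uniform
limits preserve continuity, boundedness and, in the interior, holomorphy. -/
lemma exists_isKMSFun_of_tendsto {a b : A} {u v : ℕ → A} {F : ℕ → ℂ → ℂ}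
    (hF : ∀ n, IsKMSFun (u n) (v n) (F n)) (hu : Filter.Tendsto u Filter.atTop (𝓝 a))
    (hv : Filter.Tendsto v Filter.atTop (𝓝 b)) : ∃ G, IsKMSFun a b G := by
  have hlim : Filter.Tendsto (fun p : ℕ × ℕ => ‖u p.1‖ * ‖v p.1 - v p.2‖ + ‖u p.1 - u p.2‖ * ‖v p.2‖)
      Filter.atTop (𝓝 0) := by
    rw [← Filter.prod_atTop_atTop_eq]
    have u1 := hu.comp (Filter.tendsto_fst (f := Filter.atTop) (g := (Filter.atTop : Filter ℕ)))
    have u2 := hu.comp (Filter.tendsto_snd (g := Filter.atTop) (f := (Filter.atTop : Filter ℕ)))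
    have v1 := hv.comp (Filter.tendsto_fst (f := Filter.atTop) (g := (Filter.atTop : Filter ℕ)))
    have v2 := hv.comp (Filter.tendsto_snd (g := Filter.atTop) (f := (Filter.atTop : Filter ℕ)))
    have := (u1.norm.mul (v1.sub v2).norm).add ((u1.sub u2).norm.mul v2.norm)
    simpa using this
  have hcau : UniformCauchySeqOn F Filter.atTop strip := by
    rw [Metric.uniformCauchySeqOn_iff]
    intro ε hε
    obtain ⟨⟨N₁, N₂⟩, hN⟩ := Filter.eventually_atTop.1 (hlim.eventually_lt_const hε)
    refine ⟨max N₁ N₂, fun m hm n hn z hz => ?_⟩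
    rw [dist_eq_norm]
    exact ((hF m).norm_sub_le (hF n) hz).trans_lt
      (hN (m, n) ⟨(le_max_left _ _).trans hm, (le_max_right _ _).trans hn⟩)
  have hpt : ∀ z : ℂ, ∃ w : ℂ, z ∈ strip → Filter.Tendsto (fun n => F n z) Filter.atTop (𝓝 w) := by
    intro z
    by_cases hz : z ∈ strip
    · obtain ⟨w, hw⟩ := cauchySeq_tendsto_of_complete (hcau.cauchySeq hz)
      exact ⟨w, fun _ => hw⟩
    -- Outside the strip the limit function is immaterial and is set to zero.
    · exact ⟨0, fun h => absurd h hz⟩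
  choose G hG using hpt
  have hunif : TendstoUniformlyOn F G Filter.atTop strip :=
    hcau.tendstoUniformlyOn_of_tendsto hG
  have hsub : {z : ℂ | 0 < z.im ∧ z.im < 2} ⊆ strip := fun z hz => ⟨hz.1.le, hz.2.le⟩
  have hopen : IsOpen {z : ℂ | 0 < z.im ∧ z.im < 2} :=
    (isOpen_lt continuous_const Complex.continuous_im).inter
      (isOpen_lt Complex.continuous_im continuous_const)
  refine ⟨G, ?_, ?_, ?_, fun t => ?_, fun t => ?_⟩
  · exact hunif.continuousOn (.of_forall fun n => (hF n).continuousOn)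
  · exact (hunif.mono hsub).tendstoLocallyUniformlyOn.differentiableOn
      (.of_forall fun n => (hF n).differentiableOn) hopen
  · obtain ⟨n, hn⟩ := (Metric.tendstoUniformlyOn_iff.1 hunif 1 one_pos).exists
    obtain ⟨C, hC⟩ := (hF n).bounded
    refine ⟨1 + C, fun z hz => ?_⟩
    calc ‖G z‖ = ‖(G z - F n z) + F n z‖ := by rw [sub_add_cancel]
      _ ≤ 1 + C := (norm_add_le _ _).trans
        (add_le_add (by rw [← dist_eq_norm]; exact (hn z hz).le) (hC z hz))
  · refine tendsto_nhds_unique (hG t ⟨by simp, by simp⟩) ?_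
    simp only [fun n => (hF n).bottom t]
    exact (phi.continuous.tendsto _).comp (hu.mul (((continuous_sigma t).tendsto b).comp hv))
  · refine tendsto_nhds_unique (hG (t + Complex.I * 2) ⟨by simp, by simp⟩) ?_
    simp only [fun n => (hF n).top t]
    exact (phi.continuous.tendsto _).comp ((((continuous_sigma t).tendsto b).comp hv).mul hu)

/-! ### KMS functions for elements of `𝒜`, and the density argument -/

lemma detMul_mul (s : ℂ) (f g : 𝒜) : detMul s (f * g) = f * detMul s g := by
  ext z
  change _ * (f z * g z) = f z * (_ * g z)
  ring

lemma detMul_add (s t : ℂ) (f : 𝒜) : detMul (s + t) f = detMul s (detMul t f) := by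
  ext z
  change _ * f z = _ * (_ * f z)
  rw [Complex.cpow_add _ _ (Complex.ofReal_ne_zero.2 (detZ_pos z).ne'), mul_assoc]

lemma sigma0_eq (t : ℝ) (f : 𝒜) : sigma0 t f = detMul (Complex.I * t) f := by
  ext z
  obtain ⟨x, rfl⟩ := Quotient.exists_rep z
  rfl

lemma flip_mul_flip (f g : 𝒜) : flip (flip f * g) = f * flip g := by
  ext z
  change f (invZ (invZ z)) * g (invZ z) = f z * g (invZ z)
  rw [invZ_invZ]

/-- The modulus is `x ^ (-Im z)` with exponent between `-2` and `0`: at most `1` when `x ≥ 1`, at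
most `x⁻²` when `x ≤ 1`. The sum covers both cases. -/
lemma norm_cpow_I_mul_le {x : ℝ} (hx : 0 < x) {z : ℂ} (hz : z ∈ strip) :
    ‖(x : ℂ) ^ (Complex.I * z)‖ ≤ 1 + x ^ (-2 : ℝ) := by
  have hre : (Complex.I * z).re = -z.im := by simp
  rw [Complex.norm_cpow_eq_rpow_re_of_pos hx, hre]
  have hpos : 0 < x ^ (-2 : ℝ) := Real.rpow_pos_of_pos hx _
  rcases le_total 1 x with h | h
  · have := Real.rpow_le_one_of_one_le_of_nonpos h (neg_nonpos.2 hz.1)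
    linarith
  · have := Real.rpow_le_rpow_of_exponent_ge hx h (neg_le_neg hz.2)
    linarith

/-- One holomorphic family, `det^{iz}`, interpolates between the time evolution at real `z` and the
factor `det⁻²` of `sumInt_flip` at `z = 2i`. -/
lemma isKMSFun_toA (f g : 𝒜) :
    IsKMSFun (toA f) (toA g) fun z => sumInt (detMul (Complex.I * z) (flip f * g)) := by
  obtain ⟨T, hT⟩ := exists_isRepsFor (flip f * g)
  have hd : Differentiable ℂ fun z => sumInt (detMul (Complex.I * z) (flip f * g)) := by
    simp only [sumInt_detMul hT]
    refine Differentiable.fun_sum fun t _ => Differentiable.mul_const ?_ _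
    refine Differentiable.const_cpow (by fun_prop) (Or.inl ?_)
    exact Complex.ofReal_ne_zero.2 (det_pos t).ne'
  refine ⟨hd.continuous.continuousOn, hd.differentiableOn, ?_, fun t => ?_, fun t => ?_⟩
  · refine ⟨∑ t ∈ T, (1 + t.det ^ (-2 : ℝ)) * ‖∫ y in domX, kext (⇑(flip f * g)) t y ∂nu‖,
      fun z hz => ?_⟩
    rw [sumInt_detMul hT]
    refine norm_sum_le_of_le _ fun t _ => ?_
    rw [norm_mul]
    exact mul_le_mul_of_nonneg_right (norm_cpow_I_mul_le (det_pos t) hz) (norm_nonneg _)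
  · rw [sigma_toA, ← toA_conv, phi_toA, phi0_conv, sigma0_eq, detMul_mul]
  -- The exponent splits off `-2`, which `sumInt_flip` absorbs into a flip; flipping `flip f ·
  -- σ_t(g)` gives `f · flip (σ_t(g))`, whose `sumInt` is `φ(σ_t(g) f)`.
  · have e : Complex.I * ((t : ℂ) + Complex.I * 2) = -2 + Complex.I * t := by
      linear_combination 2 * Complex.I_mul_I
    rw [sigma_toA, ← toA_conv, phi_toA, phi0_conv, e, detMul_add, ← sumInt_flip, detMul_mul,
      flip_mul_flip, sigma0_eq, mul_comm]

lemma isKMS_phi : IsKMS sigma 2 phi := by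
  intro a b
  obtain ⟨u, hu, hu'⟩ := mem_closure_iff_seq_limit.1 (denseRange_toA a)
  obtain ⟨v, hv, hv'⟩ := mem_closure_iff_seq_limit.1 (denseRange_toA b)
  choose f hf using hu
  choose g hg using hv
  obtain ⟨G, hG⟩ := exists_isKMSFun_of_tendsto (u := u) (v := v)
    (fun n => by rw [← hf n, ← hg n]; exact isKMSFun_toA (f n) (g n)) hu' hv'
  obtain ⟨C, hC⟩ := hG.bounded
  refine ⟨G, hG.continuousOn, hG.differentiableOn, ⟨C, fun z h1 h2 => hC z ⟨h1, h2⟩⟩,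
    fun t => ⟨hG.bottom t, ?_⟩⟩
  rw [Complex.ofReal_ofNat]
  exact hG.top t

/-- Two continuous maps that agree on the dense image of `𝒜` are equal. -/
lemma eq_phi {ψ : A →L[ℂ] ℂ} (h : ∀ f : 𝒜, ψ (toA f) = ∫ x : X, unitVal f x ∂muX) : ψ = phi := by
  refine ContinuousLinearMap.ext fun a => ?_
  refine congrFun (denseRange_toA.equalizer ψ.continuous phi.continuous ?_) a
  funext f
  exact (h f).trans ((integral_unitVal f).trans (phi_toA f).symm)

end

end GL2System

theorem mainTheorem5 :
    ∃ φ : GL2System.A →L[ℂ] ℂ,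
      (∀ f : GL2System.𝒜, Integrable (GL2System.unitVal f) GL2System.muX ∧
        φ (GL2System.toA f) = ∫ x : GL2System.X, GL2System.unitVal f x ∂GL2System.muX) ∧
      (∀ ψ : GL2System.A →L[ℂ] ℂ,
        (∀ f : GL2System.𝒜,
          ψ (GL2System.toA f) = ∫ x : GL2System.X, GL2System.unitVal f x ∂GL2System.muX) → ψ = φ) ∧
      GL2System.IsState φ ∧ GL2System.IsKMS GL2System.sigma 2 φ := by
  exact ⟨GL2System.phi, fun f => ⟨GL2System.integrable_unitVal f,
    (GL2System.phi_toA f).trans (GL2System.integral_unitVal f).symm⟩,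
    fun ψ hψ => GL2System.eq_phi hψ, GL2System.isState_phi, GL2System.isKMS_phi⟩
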